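/- Let $d$ be a prime, $\mathsf H$ a Hilbert space of dimension $d$ with orthonormal basis $|0\rangle,\dots,|d-1\rangle$, $\omega$ a primitive $d$-th root of unity, and $X|j\rangle=|(j-1)\bmod d\rangle$, $Z|j\rangle=\omega^j|j\rangle$. Put $\mathcal X=\{0,\dots,d-1\}^2$, $N_{(i,j)}=X^iZ^j$, and $N_x=N_{x_1}\otimes\cdots\otimes N_{x_n}$ for $x\in\mathcal X^n$; the $N_x$ form a basis of the operators on $\mathsf H^{\otimes n}$. Let $\{\mathcal A_n\}_{n\ge1}$ be a quantum channel, i.e. a sequence of trace-preserving completely positive (TPCP) linear maps $\mathcal A_n$ on the operators on $\mathsf H^{\otimes n}$. Write $\mathcal A_n(\rho)=\sum_{x\in\mathcal X^n}A^{(n)}_x\rho A^{(n)\dagger}_x$, expand $A^{(n)}_x=\sum_{y\in\mathcal X^n}a_{xy}N_y$, and put $P_{\mathcal A_n}(y)=\sum_x|a_{xy}|^2$. Assume that there are a probability distribution $p$ on $\mathcal X$ and transition probabilities $P(v|u)$, $u,v\in\mathcal X$, such that for all $n\ge1$ $$P_{\mathcal A_n}(x_1,\dots,x_n)=p(x_1)\prod_{j=1}^{n-1}P(x_{j+1}|x_j).$$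 For real $k\ge0$ let $F^\star_{n,k}(\mathcal A_n)$ be the supremum of $$\min_{\psi\in\mathcal C,\ \|\psi\|=1}\langle\psi|\,\mathcal R\mathcal A_n(|\psi\rangle\langle\psi|)\,|\psi\rangle$$ over all nonzero subspaces $\mathcal C\subset\mathsf H^{\otimes n}$ with $\log_d\dim\mathcal C\ge k$ and all TPCP maps $\mathcal R$ on the operators on $\mathsf H^{\otimes n}$. For a probability distribution $Q$ on $\mathcal X^2$ put $\bar Q(u)=\sum_vQ(u,v)$, $\bar{\bar Q}(u)=\sum_vQ(v,u)$, $\overleftarrow Q(v|u)=Q(u,v)/\bar Q(u)$ if $\bar Q(u)>0$, and $$D(Q\|P)=\sum_{u:\bar Q(u)>0}\sum_vQ(u,v)\log_d\frac{\overleftarrow Q(v|u)}{P(v|u)},\qquad H(\overleftarrow Q|\bar Q)=-\sum_{u:\bar Q(u)>0}\sum_v\bar Q(u)\overleftarrow Q(v|u)\log_d\overleftarrow Q(v|u),$$ with $\log(a/0)=\infty$ for $a>0$ and $0\log0=0\log(0/0)=0$. Then, for every $0\le R\le1$, $$\liminf_{n\to\infty}-\frac1n\log_d\bigl[1-F^\star_{n,Rn}(\mathcal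 A_n)\bigr]\ \ge\ E(R,P):=\min_{Q:\,\bar Q=\bar{\bar Q}}\bigl[D(Q\|P)+|1-H(\overleftarrow Q|\bar Q)-R|^+\bigr],$$ where $|x|^+=\max\{x,0\}$, the minimum is over all probability distributions $Q$ on $\mathcal X^2$ with $\bar Q=\bar{\bar Q}$ and is attained, and $-\log_d0=\infty$. -/

import Mathlib

/-! Conventions. The `d`-dimensional Hilbert space is `ℂ^d` with its standard orthonormal basis
indexed by `ZMod d`; its `n`-fold tensor power is `EuclideanSpace ℂ (Fin n → ZMod d)`, with product
basis vectors indexed by `Fin n → ZMod d`. Operators are matrices in these bases. -/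

noncomputable section

open scoped Matrix.Norms.L2Operator MatrixOrder ComplexOrder

namespace QCode

/-- The alphabet `{0, …, d-1}²`. -/
abbrev Alphabet (d : ℕ) : Type := ZMod d × ZMod d

/-- Index set of the product basis of the `n`-fold tensor power of `ℂ^d`. -/
abbrev Idx (d n : ℕ) : Type := Fin n → ZMod d

section Operators

variable {m : Type} [Fintype m] [DecidableEq m]

/-- Trace-preserving completely positive linear maps on operators on `ℂ^m`. -/
structure IsTPCP (Φ : Matrix m m ℂ →ₗ[ℂ] Matrix m m ℂ) : Prop where
  completelyPositive :
    ∃ Ψ : CompletelyPositiveMap (Matrix m m ℂ) (Matrix m m ℂ), Ψ.toLinearMap = Φ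
  tracePreserving : ∀ ρ : Matrix m m ℂ, (Φ ρ).trace = ρ.trace

/-- `Φ ∼ {K_i}`: the operator-sum representation `Φ ρ = ∑ i, K_i ρ K_i†`. -/
def HasKraus {ι : Type} [Fintype ι] (Φ : Matrix m m ℂ →ₗ[ℂ] Matrix m m ℂ)
    (K : ι → Matrix m m ℂ) : Prop :=
  ∀ ρ : Matrix m m ℂ, Φ ρ = ∑ i, K i * ρ * (K i).conjTranspose

/-- `⟨ψ| Φ(|ψ⟩⟨ψ|) |ψ⟩` (a real number when `Φ` is completely positive). -/
def pureFidelity (Φ : Matrix m m ℂ →ₗ[ℂ] Matrix m m ℂ) (ψ : EuclideanSpace ℂ m) : ℝ :=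
  (star (fun i => ψ i) ⬝ᵥ
    (Φ (Matrix.vecMulVec (fun i => ψ i) (star (fun i => ψ i)))).mulVec (fun i => ψ i)).re

/-- Minimum fidelity of the subspace `C` under `Φ`, over the unit vectors of `C`. -/
def minFidelity (C : Submodule ℂ (EuclideanSpace ℂ m))
    (Φ : Matrix m m ℂ →ₗ[ℂ] Matrix m m ℂ) : ℝ :=
  ⨅ ψ : {ψ : EuclideanSpace ℂ m // ψ ∈ C ∧ ‖ψ‖ = 1}, pureFidelity Φ ψ.1

end Operators

/-- `F⋆_{n,k}(𝒜)`: the supremum of the minimum fidelities of codes `(C, ℛ)`, with `ℛ` a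
trace-preserving completely positive recovery map and `log_d dim C ≥ k`. -/
def optFidelity (d n : ℕ) [NeZero d] (k : ℝ)
    (𝒜 : Matrix (Idx d n) (Idx d n) ℂ →ₗ[ℂ] Matrix (Idx d n) (Idx d n) ℂ) : ℝ :=
  sSup {F : ℝ | ∃ (C : Submodule ℂ (EuclideanSpace ℂ (Idx d n)))
      (ℛ : Matrix (Idx d n) (Idx d n) ℂ →ₗ[ℂ] Matrix (Idx d n) (Idx d n) ℂ),
      IsTPCP ℛ ∧ 0 < Module.finrank ℂ C ∧ k ≤ Real.logb d (Module.finrank ℂ C) ∧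
      F = minFidelity C (ℛ ∘ₗ 𝒜)}

section Weyl

variable {d : ℕ} [NeZero d]

/-- `X |j⟩ = |j - 1 mod d⟩`. -/
def shiftX (d : ℕ) : Matrix (ZMod d) (ZMod d) ℂ :=
  Matrix.of fun i j => if i = j - 1 then 1 else 0

/-- `Z |j⟩ = ω ^ j |j⟩`. -/
def clockZ (ω : ℂ) : Matrix (ZMod d) (ZMod d) ℂ :=
  Matrix.diagonal fun j => ω ^ j.val

/-- `N_{(i,j)} = X ^ i Z ^ j`. -/
def weyl (ω : ℂ) (u : Alphabet d) : Matrix (ZMod d) (ZMod d) ℂ :=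
  shiftX d ^ u.1.val * clockZ ω ^ u.2.val

/-- `N_x = N_{x_1} ⊗ ⋯ ⊗ N_{x_n}`, written in the product basis. -/
def weylTensor (ω : ℂ) {n : ℕ} (x : Fin n → Alphabet d) : Matrix (Idx d n) (Idx d n) ℂ :=
  Matrix.of fun a b => ∏ i, weyl ω (x i) (a i) (b i)

/-- `P` is the distribution associated with `𝒜`: for operators `𝒜 ∼ {A_x}_{x ∈ 𝒳^n}` with
expansions `A_x = ∑ y, a_{xy} N_y`, one has `P y = ∑ x, |a_{xy}|²`. -/
def IsAssociatedDistribution (ω : ℂ) {n : ℕ}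
    (𝒜 : Matrix (Idx d n) (Idx d n) ℂ →ₗ[ℂ] Matrix (Idx d n) (Idx d n) ℂ)
    (P : (Fin n → Alphabet d) → ℝ) : Prop :=
  ∃ (A : (Fin n → Alphabet d) → Matrix (Idx d n) (Idx d n) ℂ)
    (a : (Fin n → Alphabet d) → (Fin n → Alphabet d) → ℂ),
    HasKraus 𝒜 A ∧ (∀ x, A x = ∑ y, a x y • weylTensor ω y) ∧ ∀ y, P y = ∑ x, ‖a x y‖ ^ 2

end Weyl

section Information

variable {α : Type} [Fintype α]

/-- `p` is a probability distribution on `α`. -/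
def IsProb (p : α → ℝ) : Prop := (∀ u, 0 ≤ p u) ∧ ∑ u, p u = 1

/-- `P u v = P(v|u)` are transition probabilities. -/
def IsTransition (P : α → α → ℝ) : Prop := ∀ u, IsProb (P u)

/-- The law of `(x_1, …, x_{n+1})` for the homogeneous Markov chain with initial distribution `p`
and transition probabilities `P u v = P(v|u)`. -/
def markovLaw (p : α → ℝ) (P : α → α → ℝ) {n : ℕ} (x : Fin (n + 1) → α) : ℝ :=
  p (x 0) * ∏ j : Fin n, P (x j.castSucc) (x j.succ)

/-- First marginal of `Q`. -/
def marginal₁ (Q : α × α → ℝ) (u : α) : ℝ := ∑ v, Q (u, v)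

/-- Second marginal of `Q`. -/
def marginal₂ (Q : α × α → ℝ) (u : α) : ℝ := ∑ v, Q (v, u)

/-- Conditional probabilities `Q(u,v) / ∑ w, Q(u,w)`; only used where the denominator is
positive. -/
def condProb (Q : α × α → ℝ) (u v : α) : ℝ := Q (u, v) / marginal₁ Q u

open Classical in
/-- The summand `q log_d (a / b)` for `q, a, b ≥ 0`, with value `0` if `q = 0` and `∞` if `q > 0`
and `b = 0`. -/
def divTerm (d : ℕ) (q a b : ℝ) : EReal :=
  if q = 0 then 0 else if b = 0 then ⊤ else ((q * Real.logb d (a / b) : ℝ) : EReal)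

open Classical in
/-- Conditional divergence `D(Q‖P)` to base `d`. -/
def condDiv (d : ℕ) (Q : α × α → ℝ) (P : α → α → ℝ) : EReal :=
  ∑ u with 0 < marginal₁ Q u, ∑ v, divTerm d (Q (u, v)) (condProb Q u v) (P u v)

open Classical in
/-- Conditional entropy `H(P|p)` to base `d`. -/
def condEntropy (d : ℕ) (P : α → α → ℝ) (p : α → ℝ) : ℝ :=
  -∑ u with 0 < p u, ∑ v, p u * P u v * Real.logb d (P u v)

/-- `D(Q‖P) + |1 - H(Q←|Q̄) - R|⁺`. -/
def objective (d : ℕ) (R : ℝ) (P : α → α → ℝ) (Q : α × α → ℝ) : EReal :=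
  condDiv d Q P + ((max (1 - condEntropy d (condProb Q) (marginal₁ Q) - R) 0 : ℝ) : EReal)

/-- Values of the objective over the distributions `Q` on pairs with equal marginals. -/
def objectiveValues (d : ℕ) (R : ℝ) (P : α → α → ℝ) : Set EReal :=
  objective d R P '' {Q | IsProb Q ∧ marginal₁ Q = marginal₂ Q}

/-- The exponent `E(R, P)`. -/
def exponent (d : ℕ) (R : ℝ) (P : α → α → ℝ) : EReal := sInf (objectiveValues d R P)

open Classical in
/-- `log_d x` for `x ≥ 0`, with `log_d 0 = -∞`. -/
def logExt (d : ℕ) (x : ℝ) : EReal := if x ≤ 0 then ⊥ else (Real.logb d x : EReal)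

end Information

end QCode

end

noncomputable section

open scoped Matrix.Norms.L2Operator MatrixOrder ComplexOrder

namespace QCode

/-! The codes are random stabilizer-type codes, decoded to the error of least empirical entropy. For
a matrix B over ℤ/d the quadratic-phase vectors with entries d^{-n/2} χ(lᵀBl + j·l) form an
orthonormal basis indexed by j. The error with shift a and phase b sends the vector of index j to a
phase times the one of index j + b + (B+Bᵀ)a (`weylTensor_mul_quadBasis_apply`). If indices are
grouped by Tj, with T an m × n matrix, each error translates the blocks by its syndrome T(b +
(B+Bᵀ)a). The recovery reads off the translation and undoes one chosen error per syndrome.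

`exists_code` turns the probability ε of the uncorrected errors into a bound on the minimum
fidelity. Since the errors are orthogonal unitaries, the uncorrected parts B_x of the A_x satisfy tr
∑ B_x†B_x = ε · dim. Hence at least half of the eigenvalues of the compressions of ∑ B_x†B_x to the
blocks are at most 2ε, and some block contains at least dim/(2d^m) of them; the corresponding
eigenvectors span the code. For a unit code vector ψ, its images under the corrected errors lie in
distinct blocks, so they are orthonormal, and the fidelity is at least ∑ (‖A_xψ‖² - ‖B_xψ‖²) ≥ 1 -
2ε. Because only eigenvalues are counted, no isotropy or rank condition on T is needed.

For uniform B and T a nonzero error has syndrome zero with probability at most 2d^{-m}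
(`card_syndrome_eq_zero_le`). The union bound over the errors of no larger rank then controls ε for
some B and T (`exists_syndrome_decoder`).

The rank of a sequence x is the conditional entropy H(x) of its transition type Q. The key estimate
is that ∑ d^{-nH(x)} grows only polynomially (`sum_rpow_neg_entropy_le`). It bounds the number of
sequences with H ≤ h by about d^{nh}, so the contribution of x is, up to polynomial factors, at most
d^{-nH(x)} d^{-n(D + |1-H-R|⁺)}; the same estimate then sums over x. Types are only nearly balanced,
their marginals differing by O(1/n); compactness (`exists_gap`) shows that the exponent is still the
minimum over balanced Q. -/

lemma inner_self_eq_ofReal {E : Type*} [NormedAddCommGroup E] [InnerProductSpace ℂ E] (x : E) :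
    inner ℂ x x = ((‖x‖ ^ 2 : ℝ) : ℂ) := by
  rw [inner_self_eq_norm_sq_to_K]
  simp

/-! ### Kraus maps, complete positivity and the range of the fidelity. -/

section Channels

set_option linter.unusedSectionVars false

variable {m : Type} [Fintype m] [DecidableEq m]

/-- The linear map with operator-sum representation `ρ ↦ ∑ i, K_i ρ K_i†`. -/
def krausMap {ι : Type} [Fintype ι] (K : ι → Matrix m m ℂ) :
    Matrix m m ℂ →ₗ[ℂ] Matrix m m ℂ :=
  ∑ i, LinearMap.mulLeft ℂ (K i) ∘ₗ LinearMap.mulRight ℂ (K i).conjTranspose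

lemma hasKraus_krausMap {ι : Type} [Fintype ι] (K : ι → Matrix m m ℂ) :
    HasKraus (krausMap K) K := by
  intro ρ
  simp [krausMap, LinearMap.sum_apply, Matrix.mul_assoc]

lemma trace_eq_of_kraus {ι : Type} [Fintype ι] {Φ : Matrix m m ℂ →ₗ[ℂ] Matrix m m ℂ}
    {K : ι → Matrix m m ℂ} (h : HasKraus Φ K) (ρ : Matrix m m ℂ) :
    (Φ ρ).trace = ((∑ i, (K i).conjTranspose * K i) * ρ).trace := by
  rw [h ρ, Matrix.trace_sum, Finset.sum_mul, Matrix.trace_sum]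
  refine Finset.sum_congr rfl fun i _ => ?_
  rw [Matrix.trace_mul_comm, ← Matrix.mul_assoc]

/-- Conjugation by a block-diagonal matrix acts entrywise. -/
lemma cstarMatrix_conj_nonneg {k : ℕ} (M : CStarMatrix (Fin k) (Fin k) (Matrix m m ℂ))
    (hM : 0 ≤ M) (K : Matrix m m ℂ) :
    0 ≤ M.map fun ρ => K * ρ * K.conjTranspose := by
  let D : CStarMatrix (Fin k) (Fin k) (Matrix m m ℂ) :=
    CStarMatrix.ofMatrix (Matrix.diagonal fun _ => K)
  have h : (M.map fun ρ => K * ρ * K.conjTranspose) = D * M * star D := by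
    ext1 a b
    have h1 : ∀ c, (D * M) a c = K * M a c := by
      intro c
      rw [CStarMatrix.mul_apply, Finset.sum_eq_single a]
      · simp [D]
      · intro e _ he
        simp [D, Matrix.diagonal_apply_ne _ he.symm]
      · simp
    rw [CStarMatrix.mul_apply, Finset.sum_eq_single b]
    · rw [h1, CStarMatrix.star_apply]
      simp [D, Matrix.star_eq_conjTranspose]
    · intro e _ he
      rw [CStarMatrix.star_apply]
      simp [D, Matrix.diagonal_apply_ne _ he.symm]
    · simp
  rw [h]
  exact star_right_conjugate_nonneg hM D

lemma isTPCP_krausMap {ι : Type} [Fintype ι] (K : ι → Matrix m m ℂ)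
    (hK : ∑ i, (K i).conjTranspose * K i = 1) : IsTPCP (krausMap K) where
  completelyPositive := by
    refine ⟨⟨krausMap K, fun k M hM => ?_⟩, rfl⟩
    have h : M.map (krausMap K) =
        ∑ i, M.map fun ρ => K i * ρ * (K i).conjTranspose := by
      ext1 a b
      rw [CStarMatrix.map_apply, hasKraus_krausMap K (M a b)]
      have : ∀ s : Finset ι, (∑ i ∈ s, M.map fun ρ => K i * ρ * (K i).conjTranspose) a b =
          ∑ i ∈ s, K i * M a b * (K i).conjTranspose := by
        classical
        intro s
        induction s using Finset.induction_on with
        | empty => simp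
        | insert i s hi ih =>
          rw [Finset.sum_insert hi, Finset.sum_insert hi, CStarMatrix.add_apply, ih]
          rfl
      exact (this _).symm
    rw [h]
    exact Finset.sum_nonneg fun i _ => cstarMatrix_conj_nonneg M hM (K i)
  tracePreserving ρ := by
    rw [trace_eq_of_kraus (hasKraus_krausMap K), hK, Matrix.one_mul]

lemma IsTPCP.posSemidef {Φ : Matrix m m ℂ →ₗ[ℂ] Matrix m m ℂ} (hΦ : IsTPCP Φ)
    {ρ : Matrix m m ℂ} (hρ : ρ.PosSemidef) : (Φ ρ).PosSemidef := by
  obtain ⟨Ψ, rfl⟩ := hΦ.completelyPositive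
  rw [← Matrix.nonneg_iff_posSemidef] at hρ ⊢
  have h := OrderHomClass.mono Ψ hρ
  rw [map_zero] at h
  exact h

/-- `⟨ψ| X |ψ⟩ ≤ tr X` for unit vectors `ψ` and positive semidefinite `X`. -/
lemma re_dotProduct_mulVec_le_trace {X : Matrix m m ℂ} (hX : X.PosSemidef)
    (ψ : EuclideanSpace ℂ m) (hψ : ‖ψ‖ = 1) :
    (star ψ.ofLp ⬝ᵥ X.mulVec ψ.ofLp).re ≤ X.trace.re := by
  -- With X = B†B the claim becomes ‖Bψ‖² ≤ ∑ |B i j|², which is Cauchy–Schwarz in each row.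
  obtain ⟨B, rfl⟩ := CStarAlgebra.nonneg_iff_eq_star_mul_self.1
    (Matrix.nonneg_iff_posSemidef.2 hX)
  rw [Matrix.star_eq_conjTranspose]
  have h1 : star ψ.ofLp ⬝ᵥ (B.conjTranspose * B).mulVec ψ.ofLp =
      ((∑ i, ‖B.mulVec ψ.ofLp i‖ ^ 2 : ℝ) : ℂ) := by
    rw [← Matrix.mulVec_mulVec, Matrix.dotProduct_mulVec, ← Matrix.star_mulVec]
    simp [dotProduct, Complex.conj_mul']
  have h2 : (B.conjTranspose * B).trace = ((∑ i, ∑ j, ‖B i j‖ ^ 2 : ℝ) : ℂ) := by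
    rw [Finset.sum_comm]
    simp [Matrix.trace, Matrix.mul_apply, Complex.conj_mul']
  rw [h1, h2, Complex.ofReal_re, Complex.ofReal_re]
  refine Finset.sum_le_sum fun i _ => ?_
  have hn : ∑ j, ‖ψ.ofLp j‖ ^ 2 = 1 := by
    rw [← EuclideanSpace.norm_sq_eq, hψ, one_pow]
  calc ‖B.mulVec ψ.ofLp i‖ ^ 2 ≤ (∑ j, ‖B i j‖ * ‖ψ.ofLp j‖) ^ 2 := by
        gcongr
        refine (norm_sum_le _ _).trans (Finset.sum_le_sum fun j _ => ?_)
        rw [norm_mul]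
    _ ≤ (∑ j, ‖B i j‖ ^ 2) * ∑ j, ‖ψ.ofLp j‖ ^ 2 := Finset.sum_mul_sq_le_sq_mul_sq _ _ _
    _ = _ := by rw [hn, mul_one]

lemma IsTPCP.posSemidef_and_trace_comp {Φ Ψ : Matrix m m ℂ →ₗ[ℂ] Matrix m m ℂ}
    (hΦ : IsTPCP Φ) (hΨ : IsTPCP Ψ) {ρ : Matrix m m ℂ} (hρ : ρ.PosSemidef) :
    ((Φ ∘ₗ Ψ) ρ).PosSemidef ∧ ((Φ ∘ₗ Ψ) ρ).trace = ρ.trace :=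
  ⟨hΦ.posSemidef (hΨ.posSemidef hρ), by
    rw [LinearMap.comp_apply, hΦ.tracePreserving, hΨ.tracePreserving]⟩

lemma pureFidelity_comp_mem_Icc {Φ Ψ : Matrix m m ℂ →ₗ[ℂ] Matrix m m ℂ} (hΦ : IsTPCP Φ)
    (hΨ : IsTPCP Ψ) (ψ : EuclideanSpace ℂ m) (hψ : ‖ψ‖ = 1) :
    pureFidelity (Φ ∘ₗ Ψ) ψ ∈ Set.Icc (0 : ℝ) 1 := by
  obtain ⟨h1, h2⟩ := hΦ.posSemidef_and_trace_comp hΨ (Matrix.posSemidef_vecMulVec_self_star ψ.ofLp)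
  refine ⟨h1.re_dotProduct_nonneg _, ?_⟩
  refine (re_dotProduct_mulVec_le_trace h1 ψ hψ).trans ?_
  rw [h2, Matrix.trace_vecMulVec, ← EuclideanSpace.inner_eq_star_dotProduct,
    inner_self_eq_norm_sq_to_K, hψ]
  simp

lemma minFidelity_comp_mem_Icc {Φ Ψ : Matrix m m ℂ →ₗ[ℂ] Matrix m m ℂ} (hΦ : IsTPCP Φ)
    (hΨ : IsTPCP Ψ) (C : Submodule ℂ (EuclideanSpace ℂ m)) :
    minFidelity C (Φ ∘ₗ Ψ) ∈ Set.Icc (0 : ℝ) 1 := by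
  have h := fun ψ : {ψ : EuclideanSpace ℂ m // ψ ∈ C ∧ ‖ψ‖ = 1} =>
    pureFidelity_comp_mem_Icc hΦ hΨ ψ.1 ψ.2.2
  refine ⟨Real.iInf_nonneg fun ψ => (h ψ).1, ?_⟩
  rcases isEmpty_or_nonempty {ψ : EuclideanSpace ℂ m // ψ ∈ C ∧ ‖ψ‖ = 1} with he | ⟨⟨ψ⟩⟩
  -- The zero subspace has no unit vectors, and the real infimum over the empty type is 0.
  · rw [minFidelity, Real.iInf_of_isEmpty]
    exact zero_le_one
  · exact (ciInf_le ⟨0, by rintro _ ⟨φ, rfl⟩; exact (h φ).1⟩ ψ).trans (h ψ).2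

end Channels

lemma optFidelity_nonneg {d n : ℕ} [NeZero d] {k : ℝ}
    {𝒜 : Matrix (Idx d n) (Idx d n) ℂ →ₗ[ℂ] Matrix (Idx d n) (Idx d n) ℂ} (h𝒜 : IsTPCP 𝒜) :
    0 ≤ optFidelity d n k 𝒜 := by
  refine Real.sSup_nonneg ?_
  rintro _ ⟨C, ℛ, hℛ, -, -, rfl⟩
  exact (minFidelity_comp_mem_Icc hℛ h𝒜 C).1

lemma minFidelity_le_optFidelity {d n : ℕ} [NeZero d] {k : ℝ}
    {𝒜 ℛ : Matrix (Idx d n) (Idx d n) ℂ →ₗ[ℂ] Matrix (Idx d n) (Idx d n) ℂ} (h𝒜 : IsTPCP 𝒜)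
    (hℛ : IsTPCP ℛ) {C : Submodule ℂ (EuclideanSpace ℂ (Idx d n))}
    (hC : 0 < Module.finrank ℂ C) (hk : k ≤ Real.logb d (Module.finrank ℂ C)) :
    minFidelity C (ℛ ∘ₗ 𝒜) ≤ optFidelity d n k 𝒜 := by
  refine le_csSup ⟨1, ?_⟩ ⟨C, ℛ, hℛ, hC, hk, rfl⟩
  rintro _ ⟨C, ℛ, hℛ, -, -, rfl⟩
  exact (minFidelity_comp_mem_Icc hℛ h𝒜 C).2

/-! ### Action of operators on pure states; fidelity in terms of Kraus operators. -/

section PureStates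

variable {m : Type} [Fintype m] [DecidableEq m]

/-- The operator on `ℂ^m` with matrix `K`. -/
abbrev op (K : Matrix m m ℂ) : EuclideanSpace ℂ m →ₗ[ℂ] EuclideanSpace ℂ m :=
  Matrix.toEuclideanLin K

lemma op_mul_apply (K L : Matrix m m ℂ) (ψ : EuclideanSpace ℂ m) :
    op (K * L) ψ = op K (op L ψ) := by
  simp [op, Matrix.toLpLin_apply, Matrix.mulVec_mulVec]

lemma op_one_apply (ψ : EuclideanSpace ℂ m) : op (1 : Matrix m m ℂ) ψ = ψ := by
  simp [op]

lemma inner_op_left (K : Matrix m m ℂ) (φ ψ : EuclideanSpace ℂ m) :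
    inner ℂ (op K φ) ψ = inner ℂ φ (op K.conjTranspose ψ) := by
  simp only [op, Matrix.toLpLin_apply, EuclideanSpace.inner_eq_star_dotProduct,
    Matrix.star_mulVec]
  rw [dotProduct_comm, ← Matrix.dotProduct_mulVec, dotProduct_comm]

lemma norm_op_sq (K : Matrix m m ℂ) (ψ : EuclideanSpace ℂ m) :
    ((‖op K ψ‖ ^ 2 : ℝ) : ℂ) = inner ℂ ψ (op (K.conjTranspose * K) ψ) := by
  rw [op_mul_apply, ← inner_op_left, inner_self_eq_ofReal]

lemma norm_op_of_isometry {K : Matrix m m ℂ} (hK : K.conjTranspose * K = 1)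
    (ψ : EuclideanSpace ℂ m) : ‖op K ψ‖ = ‖ψ‖ := by
  have h := norm_op_sq K ψ
  rw [hK, op_one_apply, inner_self_eq_ofReal] at h
  have h' : ‖op K ψ‖ ^ 2 = ‖ψ‖ ^ 2 := by exact_mod_cast h
  exact (pow_left_inj₀ (norm_nonneg _) (norm_nonneg _) two_ne_zero).1 h'

lemma pureFidelity_eq_of_kraus {ι : Type} [Fintype ι] {Φ : Matrix m m ℂ →ₗ[ℂ] Matrix m m ℂ}
    {K : ι → Matrix m m ℂ} (h : HasKraus Φ K) (ψ : EuclideanSpace ℂ m) :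
    pureFidelity Φ ψ = ∑ i, ‖inner ℂ ψ (op (K i) ψ)‖ ^ 2 := by
  rw [pureFidelity, h, Matrix.sum_mulVec, dotProduct_sum, Complex.re_sum]
  refine Finset.sum_congr rfl fun i _ => ?_
  have h1 : inner ℂ ψ (op (K i) ψ) = star ψ.ofLp ⬝ᵥ (K i).mulVec ψ.ofLp := by
    rw [EuclideanSpace.inner_eq_star_dotProduct, dotProduct_comm]
    rfl
  have h2 : star ψ.ofLp ⬝ᵥ (K i * Matrix.vecMulVec ψ.ofLp (star ψ.ofLp) *
      (K i).conjTranspose).mulVec ψ.ofLp =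
      (star ψ.ofLp ⬝ᵥ (K i).mulVec ψ.ofLp) * star (star ψ.ofLp ⬝ᵥ (K i).mulVec ψ.ofLp) := by
    rw [Matrix.mul_vecMulVec, Matrix.vecMulVec_mul, Matrix.vecMulVec_mulVec]
    rw [← Matrix.star_mulVec, dotProduct_smul]
    rw [Matrix.star_dotProduct]
    simp [dotProduct_comm]
  change (star ψ.ofLp ⬝ᵥ _).re = _
  rw [h2, h1]
  rw [Complex.star_def, Complex.mul_conj']
  norm_cast

lemma sum_norm_op_sq_of_kraus {ι : Type} [Fintype ι] {Φ : Matrix m m ℂ →ₗ[ℂ] Matrix m m ℂ}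
    {K : ι → Matrix m m ℂ} (h : HasKraus Φ K) (htr : ∀ ρ, (Φ ρ).trace = ρ.trace)
    (ψ : EuclideanSpace ℂ m) : ∑ i, ‖op (K i) ψ‖ ^ 2 = ‖ψ‖ ^ 2 := by
  have h1 := (trace_eq_of_kraus h (Matrix.vecMulVec ψ.ofLp (star ψ.ofLp))).symm.trans (htr _)
  rw [Matrix.mul_vecMulVec, Matrix.trace_vecMulVec, Matrix.trace_vecMulVec,
    ← EuclideanSpace.inner_eq_star_dotProduct ψ ψ, inner_self_eq_ofReal,
    Matrix.sum_mulVec, sum_dotProduct] at h1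
  have h2 : ∀ i, ((K i).conjTranspose * K i).mulVec ψ.ofLp ⬝ᵥ star ψ.ofLp =
      ((‖op (K i) ψ‖ ^ 2 : ℝ) : ℂ) := by
    intro i
    rw [norm_op_sq, EuclideanSpace.inner_eq_star_dotProduct]
    rfl
  simp only [h2] at h1
  exact_mod_cast h1

/-- The residual of the orthogonal projection onto `span u` is at most the distance to any
combination of the `u_i`. -/
lemma norm_sq_sub_le_of_orthonormal {E κ : Type*} [NormedAddCommGroup E] [InnerProductSpace ℂ E]
    [Fintype κ] {u : κ → E} (hu : Orthonormal ℂ u) (w : E) (c : κ → ℂ) :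
    ‖w‖ ^ 2 - ∑ i, ‖inner ℂ (u i) w‖ ^ 2 ≤ ‖w - ∑ i, c i • u i‖ ^ 2 := by
  have h1 : inner ℂ (∑ i, c i • u i) (∑ i, c i • u i) = ((∑ i, ‖c i‖ ^ 2 : ℝ) : ℂ) := by
    rw [hu.inner_sum]
    simp [Complex.conj_mul']
  have h2 : ‖∑ i, c i • u i‖ ^ 2 = ∑ i, ‖c i‖ ^ 2 := by
    rw [inner_self_eq_ofReal] at h1
    exact_mod_cast h1
  have h3 : inner ℂ w (∑ i, c i • u i) = ∑ i, c i * star (inner ℂ (u i) w) := by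
    rw [inner_sum]
    refine Finset.sum_congr rfl fun i _ => ?_
    rw [inner_smul_right, ← inner_conj_symm w]
    rfl
  rw [@norm_sub_sq ℂ, h2, h3]
  have h4 : ∀ i, 2 * (c i * star (inner ℂ (u i) w)).re ≤ ‖c i‖ ^ 2 + ‖inner ℂ (u i) w‖ ^ 2 := by
    intro i
    have := (Complex.re_le_norm (c i * star (inner ℂ (u i) w)))
    rw [norm_mul, norm_star] at this
    nlinarith [sq_nonneg (‖c i‖ - ‖inner ℂ (u i) w‖)]
  have h5 := Finset.sum_le_sum fun i (_ : i ∈ Finset.univ) => h4 i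
  rw [← Finset.mul_sum, Finset.sum_add_distrib] at h5
  simp only [RCLike.re_to_complex, Complex.re_sum]
  linarith

end PureStates

/-! ### Codes from errors that permute blocks of a basis. -/

section Codes

set_option linter.unusedSectionVars false

/-- At least half of nonnegative numbers are at most twice their mean. -/
lemma card_le_two_mul_card_filter {κ : Type*} [Fintype κ] (μ : κ → ℝ) (hμ : ∀ i, 0 ≤ μ i)
    {ε : ℝ} (h : ∑ i, μ i ≤ Fintype.card κ * ε) :
    Fintype.card κ ≤ 2 * (Finset.univ.filter fun i => μ i ≤ 2 * ε).card := by
  by_contra! hlt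
  have hpos : (0 : ℝ) < Fintype.card κ := by
    exact_mod_cast (Nat.zero_le _).trans_lt hlt
  have hε : 0 ≤ ε := by
    have := (Finset.sum_nonneg fun i (_ : i ∈ Finset.univ) => hμ i).trans h
    exact nonneg_of_mul_nonneg_right this hpos
  have hcard := Finset.card_filter_add_card_filter_not (s := (Finset.univ : Finset κ))
    (fun i => μ i ≤ 2 * ε)
  rw [Finset.card_univ] at hcard
  set B := Finset.univ.filter fun i => ¬ μ i ≤ 2 * ε with hB
  have hBc : Fintype.card κ < 2 * B.card := by omega
  have hBne : B.Nonempty := Finset.card_pos.1 (by omega)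
  have h1 : ∑ _i ∈ B, 2 * ε < ∑ i ∈ B, μ i := by
    refine Finset.sum_lt_sum_of_nonempty hBne fun i hi => ?_
    simpa [hB] using hi
  have h2 : ∑ i ∈ B, μ i ≤ ∑ i, μ i :=
    Finset.sum_le_sum_of_subset_of_nonneg (Finset.subset_univ _) fun i _ _ => hμ i
  rw [Finset.sum_const, nsmul_eq_mul] at h1
  have h3 : (Fintype.card κ : ℝ) ≤ 2 * B.card := by exact_mod_cast hBc.le
  nlinarith

variable {ι : Type} [Fintype ι] [DecidableEq ι]

/-- Extension by zero from the coordinates in a fibre of `g`. -/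
def extendFiber {G : Type} [DecidableEq G] (g : ι → G) (s : G) :
    EuclideanSpace ℂ {j // g j = s} →ₗ[ℂ] EuclideanSpace ℂ ι where
  toFun φ := WithLp.toLp 2 fun j => if h : g j = s then φ ⟨j, h⟩ else 0
  map_add' φ ψ := by
    ext j
    by_cases h : g j = s <;> simp [h]
  map_smul' c φ := by
    ext j
    by_cases h : g j = s <;> simp [h]

lemma extendFiber_apply_of_ne {G : Type} [DecidableEq G] (g : ι → G) (s : G)
    (φ : EuclideanSpace ℂ {j // g j = s}) {j : ι} (h : g j ≠ s) : extendFiber g s φ j = 0 := by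
  simp [extendFiber, h]

lemma extendFiber_apply_coe {G : Type} [DecidableEq G] (g : ι → G) (s : G)
    (φ : EuclideanSpace ℂ {j // g j = s}) (j : {j // g j = s}) :
    extendFiber g s φ j = φ j := by
  simp [extendFiber, j.2]

lemma sum_fiber_eq_of_zero {G M : Type*} [AddCommMonoid M] [DecidableEq G] (g : ι → G) (s : G)
    (f : ι → M) (hf : ∀ j, g j ≠ s → f j = 0) : ∑ j : {j // g j = s}, f j = ∑ j, f j := by
  rw [← Finset.sum_subtype (Finset.univ.filter fun j => g j = s) (by simp) f, Finset.sum_filter]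
  refine Finset.sum_congr rfl fun j _ => ?_
  by_cases h : g j = s
  · simp [h]
  · simp [h, hf j h]

lemma inner_extendFiber_left {G : Type} [DecidableEq G] (g : ι → G) (s : G)
    (φ : EuclideanSpace ℂ {j // g j = s}) (ψ : EuclideanSpace ℂ ι) :
    inner ℂ (extendFiber g s φ) ψ = inner ℂ φ (WithLp.toLp 2 fun j => ψ j.1) := by
  rw [PiLp.inner_apply, PiLp.inner_apply, ← sum_fiber_eq_of_zero g s]
  · refine Finset.sum_congr rfl fun j _ => ?_
    rw [extendFiber_apply_coe]
  · intro j hj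
    rw [extendFiber_apply_of_ne g s φ hj, inner_zero_left]

lemma norm_extendFiber {G : Type} [DecidableEq G] (g : ι → G) (s : G)
    (φ : EuclideanSpace ℂ {j // g j = s}) : ‖extendFiber g s φ‖ = ‖φ‖ := by
  have h := inner_extendFiber_left g s φ (extendFiber g s φ)
  have h' : (WithLp.toLp 2 fun j : {j // g j = s} => extendFiber g s φ j.1) = φ := by
    ext j
    exact extendFiber_apply_coe g s φ j
  rw [h', inner_self_eq_ofReal, inner_self_eq_ofReal] at h
  have h'' : ‖extendFiber g s φ‖ ^ 2 = ‖φ‖ ^ 2 := by exact_mod_cast h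
  exact (pow_left_inj₀ (norm_nonneg _) (norm_nonneg _) two_ne_zero).1 h''

lemma inner_op_extendFiber {G : Type} [DecidableEq G] (g : ι → G) (s : G) (M : Matrix ι ι ℂ)
    (φ : EuclideanSpace ℂ {j // g j = s}) :
    inner ℂ (extendFiber g s φ) (op M (extendFiber g s φ)) =
      inner ℂ φ (op (M.submatrix (fun j : {j // g j = s} => j.1) fun j => j.1) φ) := by
  rw [inner_extendFiber_left]
  congr 1
  ext i
  simp only [op, Matrix.toLpLin_apply, Matrix.mulVec, dotProduct, Matrix.submatrix_apply]
  rw [← sum_fiber_eq_of_zero g s]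
  · refine Finset.sum_congr rfl fun j _ => ?_
    rw [extendFiber_apply_coe]
  · intro j hj
    rw [extendFiber_apply_of_ne g s φ hj, mul_zero]

/-- On the span of the eigenvectors with eigenvalues at most `c`, the quadratic form of `M` is at
most `c`. -/
lemma re_inner_op_le_of_mem_span {M : Matrix ι ι ℂ} (hM : M.IsHermitian) (c : ℝ)
    {χ : EuclideanSpace ℂ ι}
    (hχ : χ ∈ Submodule.span ℂ (Set.range fun i : {i // hM.eigenvalues i ≤ c} =>
      hM.eigenvectorBasis i.1)) :
    (inner ℂ χ (op M χ)).re ≤ c * ‖χ‖ ^ 2 := by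
  set f := hM.eigenvectorBasis with hf
  have h1 : ∀ i, inner ℂ (f i) (op M χ) = (hM.eigenvalues i : ℂ) * inner ℂ (f i) χ := by
    intro i
    have hop : op M (f i) = (hM.eigenvalues i : ℂ) • f i := by
      ext k
      have := congrFun (hM.mulVec_eigenvectorBasis i) k
      simpa [op, Matrix.toLpLin_apply] using this
    have := inner_op_left M (f i) χ
    rw [hM.eq] at this
    rw [← this, hop, inner_smul_left, Complex.conj_ofReal]
  have h2 : ∀ i, ¬ hM.eigenvalues i ≤ c → inner ℂ (f i) χ = 0 := by
    intro i hi
    clear h1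
    induction hχ using Submodule.span_induction with
    | mem x hx =>
      obtain ⟨k, rfl⟩ := hx
      exact f.orthonormal.2 fun h => hi (h ▸ k.2)
    | zero => simp
    | add x y _ _ hx hy => rw [inner_add_right, hx, hy, add_zero]
    | smul a x _ hx => rw [inner_smul_right, hx, mul_zero]
  have h3 : inner ℂ χ (op M χ) = ((∑ i, hM.eigenvalues i * ‖inner ℂ (f i) χ‖ ^ 2 : ℝ) : ℂ) := by
    rw [← f.sum_inner_mul_inner]
    push_cast
    refine Finset.sum_congr rfl fun i _ => ?_
    rw [h1, ← inner_conj_symm χ, mul_left_comm, Complex.conj_mul']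
  rw [h3, Complex.ofReal_re, ← f.sum_sq_norm_inner_right χ, Finset.mul_sum]
  refine Finset.sum_le_sum fun i _ => ?_
  by_cases hi : hM.eigenvalues i ≤ c
  · gcongr
  · simp [h2 i hi]

/-- The diagonal blocks of M have, together, `card ι` eigenvalues with sum tr M, so at least half of
them are at most 2ε. By pigeonhole some block contains a 1/|G| share of these, and their
eigenvectors span C. Blocks may be empty or of unequal size. -/
lemma exists_block_subspace {G : Type} [Fintype G] [Nonempty G] [DecidableEq G]
    {M : Matrix ι ι ℂ} (hM : M.PosSemidef) (g : ι → G) {ε : ℝ}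
    (hε : M.trace.re ≤ Fintype.card ι * ε) :
    ∃ (s : G) (C : Submodule ℂ (EuclideanSpace ℂ ι)),
      Fintype.card ι ≤ 2 * Fintype.card G * Module.finrank ℂ C ∧
      ∀ φ ∈ C, (∀ j, g j ≠ s → φ j = 0) ∧ (inner ℂ φ (op M φ)).re ≤ 2 * ε * ‖φ‖ ^ 2 := by
  have hs : ∀ s, (M.submatrix (fun j : {j // g j = s} => j.1) fun j => j.1).PosSemidef :=
    fun s => hM.submatrix _
  let μ : (Σ s, {j // g j = s}) → ℝ := fun p => (hs p.1).1.eigenvalues p.2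
  have hcard : Fintype.card (Σ s, {j // g j = s}) = Fintype.card ι :=
    Fintype.card_congr (Equiv.sigmaFiberEquiv g)
  have hsum : ∑ p, μ p = M.trace.re := by
    rw [Fintype.sum_sigma]
    have h1 : ∀ s, ∑ i, μ ⟨s, i⟩ = ∑ j : {j // g j = s}, (M j.1 j.1).re := by
      intro s
      have := congrArg Complex.re (hs s).1.trace_eq_sum_eigenvalues
      rw [Complex.re_sum] at this
      simp only [Matrix.trace, Matrix.diag_apply, Matrix.submatrix_apply, Complex.re_sum] at this
      rw [this]
      simp [μ]
    simp only [h1]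
    rw [← Fintype.sum_sigma' (fun s (j : {j // g j = s}) => (M j.1 j.1).re)]
    rw [Matrix.trace, Complex.re_sum]
    exact (Equiv.sigmaFiberEquiv g).sum_comp fun j => (M j j).re
  have hhalf := card_le_two_mul_card_filter μ (fun p => (hs p.1).eigenvalues_nonneg p.2)
    (ε := ε) (by rw [hsum, hcard]; exact hε)
  rw [hcard] at hhalf
  have hfib : (Finset.univ.filter fun p => μ p ≤ 2 * ε).card =
      ∑ s, Fintype.card {i : {j // g j = s} // (hs s).1.eigenvalues i ≤ 2 * ε} := by
    rw [Finset.card_filter, Fintype.sum_sigma]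
    refine Finset.sum_congr rfl fun s _ => ?_
    rw [Fintype.card_subtype, Finset.card_filter]
  have hex : ∃ s, Fintype.card ι ≤ 2 * Fintype.card G *
      Fintype.card {i : {j // g j = s} // (hs s).1.eigenvalues i ≤ 2 * ε} := by
    by_contra! hlt
    have := Finset.sum_lt_sum_of_nonempty (s := (Finset.univ : Finset G))
      Finset.univ_nonempty fun s _ => hlt s
    rw [← Finset.mul_sum, ← hfib, Finset.sum_const, Finset.card_univ, smul_eq_mul] at this
    nlinarith
  obtain ⟨s, hsc⟩ := hex
  have hinj : Function.Injective (extendFiber g s) := by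
    rw [← LinearMap.ker_eq_bot, LinearMap.ker_eq_bot']
    intro φ hφ
    rw [← norm_eq_zero, ← norm_extendFiber g s, hφ, norm_zero]
  refine ⟨s, (Submodule.span ℂ (Set.range
    fun i : {i : {j // g j = s} // (hs s).1.eigenvalues i ≤ 2 * ε} =>
      (hs s).1.eigenvectorBasis i.1)).map (extendFiber g s), ?_, ?_⟩
  · rw [← (Submodule.equivMapOfInjective _ hinj _).finrank_eq, finrank_span_eq_card]
    · exact hsc
    · exact (hs s).1.eigenvectorBasis.toBasis.linearIndependent.comp _ Subtype.val_injective
  · rintro _ ⟨χ, hχ, rfl⟩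
    refine ⟨fun j hj => extendFiber_apply_of_ne g s χ hj, ?_⟩
    rw [inner_op_extendFiber, norm_extendFiber]
    exact re_inner_op_le_of_mem_span (hs s).1 _ hχ

/-- `φ` is supported on the fibre of `g` over `s`. -/
def SupportedOn {G : Type} (g : ι → G) (s : G) (φ : EuclideanSpace ℂ ι) : Prop :=
  ∀ j, g j ≠ s → φ j = 0

lemma inner_eq_zero_of_supportedOn {G : Type} {g : ι → G} {s t : G} (hst : s ≠ t)
    {φ χ : EuclideanSpace ℂ ι} (hφ : SupportedOn g s φ) (hχ : SupportedOn g t χ) :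
    inner ℂ φ χ = 0 := by
  rw [PiLp.inner_apply]
  refine Finset.sum_eq_zero fun j _ => ?_
  by_cases h : g j = s
  · rw [hχ j (h ▸ hst), inner_zero_right]
  · rw [hφ j h, inner_zero_left]

lemma supportedOn_op {G : Type} {g : ι → G} {s t : G} {K : Matrix ι ι ℂ}
    (hK : ∀ i j, g j = s → g i ≠ t → K i j = 0) {φ : EuclideanSpace ℂ ι}
    (hφ : SupportedOn g s φ) : SupportedOn g t (op K φ) := by
  intro i hi
  simp only [op, Matrix.toLpLin_apply, Matrix.mulVec, dotProduct]
  refine Finset.sum_eq_zero fun j _ => ?_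
  by_cases h : g j = s
  · rw [hK i j h hi, zero_mul]
  · rw [hφ j h, mul_zero]

/-- The projection onto the span of the columns `j` of `V` with `g j = t`. -/
def blockProj {G : Type} [DecidableEq G] (V : Matrix ι ι ℂ) (g : ι → G) (t : G) :
    Matrix ι ι ℂ :=
  V * Matrix.diagonal (fun j => if g j = t then 1 else 0) * V.conjTranspose

section BlockProj

variable {G : Type} [DecidableEq G] {V : Matrix ι ι ℂ} (g : ι → G)

lemma blockProj_conjTranspose (t : G) :
    (blockProj V g t).conjTranspose = blockProj V g t := by
  rw [blockProj, Matrix.conjTranspose_mul, Matrix.conjTranspose_mul,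
    Matrix.conjTranspose_conjTranspose, Matrix.diagonal_conjTranspose, Matrix.mul_assoc]
  congr 3
  ext j
  simp only [Pi.star_apply]
  split_ifs <;> simp

lemma blockProj_mul_self (hV : V.conjTranspose * V = 1) (t : G) :
    blockProj V g t * blockProj V g t = blockProj V g t := by
  calc _ = V * (Matrix.diagonal (fun j => if g j = t then (1 : ℂ) else 0) *
        (V.conjTranspose * V) * Matrix.diagonal (fun j => if g j = t then 1 else 0)) *
          V.conjTranspose := by simp only [blockProj, Matrix.mul_assoc]
    _ = _ := by
      rw [hV, Matrix.mul_one, Matrix.diagonal_mul_diagonal, blockProj]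
      congr 3
      ext j
      split_ifs <;> simp

lemma sum_blockProj (hV : V.conjTranspose * V = 1) [Fintype G] : ∑ t, blockProj V g t = 1 := by
  simp only [blockProj]
  rw [← Finset.sum_mul, ← Finset.mul_sum]
  have : ∑ t, Matrix.diagonal (fun j => if g j = t then (1 : ℂ) else 0) = 1 := by
    ext i j
    rw [Matrix.sum_apply]
    by_cases h : i = j
    · subst h
      simp
    · simp [Matrix.diagonal_apply_ne _ h, Matrix.one_apply_ne h]
  rw [this, Matrix.mul_one]
  exact mul_eq_one_comm.1 hV

lemma op_blockProj (hV : V.conjTranspose * V = 1) {t : G} {φ : EuclideanSpace ℂ ι}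
    (hφ : SupportedOn g t φ) :
    op (blockProj V g t) (op V φ) = op V φ := by
  rw [← op_mul_apply, blockProj, Matrix.mul_assoc, hV, Matrix.mul_one, op_mul_apply]
  congr 1
  ext j
  simp only [op, Matrix.toLpLin_apply, Matrix.mulVec_diagonal]
  by_cases h : g j = t
  · simp [h]
  · simp [h, hφ j h]

end BlockProj

/-- Block codes for a basis of error operators. The columns of the unitary `V`, grouped by `g`,
span subspaces that the errors `N_y` permute by translating the group label by `h y`; `z` selects
the error that is corrected for each syndrome. -/
theorem exists_code {G Y X : Type} [Fintype G] [AddCommGroup G] [DecidableEq G]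
    [Fintype Y] [DecidableEq Y] [Fintype X]
    {V : Matrix ι ι ℂ} (hV : V.conjTranspose * V = 1) (g : ι → G)
    {N : Y → Matrix ι ι ℂ} (h : Y → G) (hN : ∀ y, (N y).conjTranspose * N y = 1)
    (hNV : ∀ y i j, g i ≠ g j + h y → (V.conjTranspose * N y * V) i j = 0)
    (horth : ∀ y y', y ≠ y' → ((N y).conjTranspose * N y').trace = 0)
    {A : X → Matrix ι ι ℂ} {a : X → Y → ℂ} (hA : ∀ x, A x = ∑ y, a x y • N y)
    {𝒜 : Matrix ι ι ℂ →ₗ[ℂ] Matrix ι ι ℂ} (hK : HasKraus 𝒜 A)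
    (htr : ∀ ρ, (𝒜 ρ).trace = ρ.trace) (z : G → Y) [Nonempty ι] :
    ∃ (C : Submodule ℂ (EuclideanSpace ℂ ι)) (ℛ : Matrix ι ι ℂ →ₗ[ℂ] Matrix ι ι ℂ),
      IsTPCP ℛ ∧ Fintype.card ι ≤ 2 * Fintype.card G * Module.finrank ℂ C ∧
      1 - 2 * ∑ y with z (h y) ≠ y, ∑ x, ‖a x y‖ ^ 2 ≤ minFidelity C (ℛ ∘ₗ 𝒜) := by
  set ε := ∑ y with z (h y) ≠ y, ∑ x, ‖a x y‖ ^ 2 with hε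
  -- The part of A x carried by the errors that the recovery does not correct.
  let B : X → Matrix ι ι ℂ := fun x => ∑ y with z (h y) ≠ y, a x y • N y
  let M : Matrix ι ι ℂ := ∑ x, (B x).conjTranspose * B x
  have hM : M.PosSemidef :=
    Matrix.posSemidef_sum _ fun x _ => Matrix.posSemidef_conjTranspose_mul_self _
  -- Trace orthogonality of the errors removes the cross terms.
  have hBtr : ∀ x, ((B x).conjTranspose * B x).trace =
      ((Fintype.card ι * ∑ y with z (h y) ≠ y, ‖a x y‖ ^ 2 : ℝ) : ℂ) := by
    intro x
    simp only [B, Matrix.conjTranspose_sum, Matrix.conjTranspose_smul, Finset.sum_mul,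
      Finset.mul_sum, Matrix.trace_sum, Matrix.smul_mul, Matrix.mul_smul, Matrix.trace_smul]
    push_cast
    refine Finset.sum_congr rfl fun y hy => ?_
    rw [Finset.sum_eq_single_of_mem y hy]
    · rw [hN, Matrix.trace_one, smul_eq_mul, smul_eq_mul, ← Complex.mul_conj', Complex.star_def]
      ring
    · intro y' _ hne
      rw [horth y' y hne, smul_zero, smul_zero]
  have hMtr : M.trace.re = Fintype.card ι * ε := by
    simp only [M, Matrix.trace_sum, hBtr]
    rw [← Complex.ofReal_sum, Complex.ofReal_re, ← Finset.mul_sum, Finset.sum_comm]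
  have hVV : V * V.conjTranspose = 1 := mul_eq_one_comm.1 hV
  obtain ⟨s, C', hcard, hC'⟩ := exists_block_subspace (hM.conjTranspose_mul_mul_same V) g
    (ε := ε) (by rw [Matrix.trace_mul_cycle, hVV, Matrix.one_mul, hMtr])
  have hinj : Function.Injective (op V) := by
    rw [← LinearMap.ker_eq_bot, LinearMap.ker_eq_bot']
    intro φ hφ
    rw [← norm_eq_zero, ← norm_op_of_isometry hV, hφ, norm_zero]
  -- Observe that the block has moved from s to s + t, then undo the error chosen for t.
  let Rec : G → Matrix ι ι ℂ := fun t => (N (z t)).conjTranspose * blockProj V g (s + t)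
  have hRec : ∑ t, (Rec t).conjTranspose * Rec t = 1 := by
    rw [← sum_blockProj g hV, ← Equiv.sum_comp (Equiv.addLeft s) (blockProj V g)]
    refine Finset.sum_congr rfl fun t _ => ?_
    simp only [Rec, Equiv.coe_addLeft, Matrix.conjTranspose_mul,
      Matrix.conjTranspose_conjTranspose, blockProj_conjTranspose]
    rw [Matrix.mul_assoc, ← Matrix.mul_assoc (N (z t)), mul_eq_one_comm.1 (hN (z t)),
      Matrix.one_mul, blockProj_mul_self g hV]
  refine ⟨C'.map (op V), krausMap Rec, isTPCP_krausMap _ hRec, ?_, ?_⟩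
  · rwa [← (Submodule.equivMapOfInjective _ hinj _).finrank_eq]
  have hfr : 0 < Module.finrank ℂ C' := by
    have := Fintype.card_pos (α := ι)
    exact Nat.pos_of_ne_zero fun h0 => by simp [h0] at hcard
  have hne : Nonempty {ψ : EuclideanSpace ℂ ι // ψ ∈ C'.map (op V) ∧ ‖ψ‖ = 1} := by
    have : Nontrivial C' := Module.finrank_pos_iff.1 hfr
    obtain ⟨φ, hφ⟩ := exists_norm_eq C' zero_le_one
    exact ⟨⟨op V φ, ⟨φ, φ.2, rfl⟩, by rw [norm_op_of_isometry hV]; exact hφ⟩⟩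
  refine le_ciInf ?_
  rintro ⟨_, ⟨φ, hφ, rfl⟩, hnorm⟩
  set ψ := op V φ with hψ
  have hφs : SupportedOn g s φ := (hC' φ hφ).1
  have hNψ : ∀ y, ∃ χ, SupportedOn g (s + h y) χ ∧ op (N y) ψ = op V χ := by
    intro y
    refine ⟨op (V.conjTranspose * N y * V) φ, supportedOn_op ?_ hφs, ?_⟩
    · intro i j hj hi
      exact hNV y i j (hj ▸ hi)
    · rw [← op_mul_apply V, ← Matrix.mul_assoc, ← Matrix.mul_assoc, hVV, Matrix.one_mul,
        op_mul_apply]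
  -- A corrected error is determined by its syndrome, so distinct corrected errors move ψ to
  -- different blocks.
  have hu : Orthonormal ℂ fun y : {y // z (h y) = y} => op (N y) ψ := by
    refine ⟨fun y => by rw [norm_op_of_isometry (hN y), hnorm], fun y y' hyy' => ?_⟩
    obtain ⟨χ, hχ, h1⟩ := hNψ y
    obtain ⟨χ', hχ', h2⟩ := hNψ y'
    have hne : s + h y ≠ s + h y' := by
      intro he
      apply hyy'
      ext
      rw [← y.2, ← y'.2, add_left_cancel he]
    change inner ℂ (op (N y) ψ) (op (N y') ψ) = 0
    rw [h1, h2, inner_op_left, ← op_mul_apply, hV, op_one_apply]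
    exact inner_eq_zero_of_supportedOn hne hχ hχ'
  have hKc : HasKraus (krausMap Rec ∘ₗ 𝒜) fun p : X × G => Rec p.2 * A p.1 := by
    intro ρ
    rw [LinearMap.comp_apply, hK ρ, map_sum, Fintype.sum_prod_type]
    refine Finset.sum_congr rfl fun x _ => ?_
    rw [hasKraus_krausMap Rec]
    refine Finset.sum_congr rfl fun t _ => ?_
    simp only [Matrix.conjTranspose_mul, Matrix.mul_assoc]
  change _ ≤ pureFidelity _ ψ
  rw [pureFidelity_eq_of_kraus hKc, Fintype.sum_prod_type]
  -- Bessel's residual for A x ψ is at most its distance to the combination with coefficients a x y,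
  -- and that difference is exactly B x ψ.
  have hx : ∀ x, ‖op (A x) ψ‖ ^ 2 - ‖op (B x) ψ‖ ^ 2 ≤
      ∑ t, ‖inner ℂ ψ (op (Rec t * A x) ψ)‖ ^ 2 := by
    intro x
    have h1 := norm_sq_sub_le_of_orthonormal hu (op (A x) ψ) fun y => a x y
    have h2 : op (A x) ψ - ∑ y : {y // z (h y) = y}, a x y • op (N y) ψ = op (B x) ψ := by
      rw [sub_eq_iff_eq_add, hA x]
      simp only [B, op, map_sum, LinearMap.sum_apply, map_smul, LinearMap.smul_apply]
      rw [← Finset.sum_subtype (Finset.univ.filter fun y => z (h y) = y) (by simp)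
        fun y => a x y • Matrix.toEuclideanLin (N y) ψ, add_comm]
      exact (Finset.sum_filter_add_sum_filter_not _ _ _).symm
    rw [h2] at h1
    -- N y ψ lies in the block selected by the projection, so the adjoint of the recovery operator
    -- maps ψ to N y ψ.
    have h3 : ∀ y : {y // z (h y) = y},
        inner ℂ (op (N y) ψ) (op (A x) ψ) = inner ℂ ψ (op (Rec (h y) * A x) ψ) := by
      intro y
      obtain ⟨χ, hχ, hy⟩ := hNψ y
      simp only [Rec]
      rw [y.2, op_mul_apply, op_mul_apply, ← inner_op_left,
        ← blockProj_conjTranspose, ← inner_op_left, hy, op_blockProj g hV hχ]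
    have h4 : ∑ y : {y // z (h y) = y}, ‖inner ℂ (op (N y) ψ) (op (A x) ψ)‖ ^ 2 ≤
        ∑ t, ‖inner ℂ ψ (op (Rec t * A x) ψ)‖ ^ 2 := by
      simp only [h3]
      have hi : Function.Injective fun y : {y // z (h y) = y} => h y := by
        intro y y' he
        ext
        rw [← y.2, ← y'.2]
        exact congrArg z he
      refine (Finset.sum_map Finset.univ ⟨_, hi⟩
        fun t => ‖inner ℂ ψ (op (Rec t * A x) ψ)‖ ^ 2).symm.trans_le ?_
      exact Finset.sum_le_sum_of_subset_of_nonneg (Finset.subset_univ _) fun _ _ _ => by positivity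
    linarith
  have hAs : ∑ x, ‖op (A x) ψ‖ ^ 2 = 1 := by
    rw [sum_norm_op_sq_of_kraus hK htr, hnorm, one_pow]
  have hBs : ∑ x, ‖op (B x) ψ‖ ^ 2 ≤ 2 * ε := by
    have h1 : ((∑ x, ‖op (B x) ψ‖ ^ 2 : ℝ) : ℂ) =
        inner ℂ φ (op (V.conjTranspose * M * V) φ) := by
      rw [op_mul_apply, op_mul_apply, ← inner_op_left]
      simp only [Complex.ofReal_sum, norm_op_sq, M, op, map_sum, LinearMap.sum_apply, inner_sum]
      rfl
    have h2 := (hC' φ hφ).2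
    rw [← h1, Complex.ofReal_re, ← norm_op_of_isometry hV φ, hnorm] at h2
    linarith
  have := Finset.sum_le_sum fun x (_ : x ∈ Finset.univ) => hx x
  rw [Finset.sum_sub_distrib, hAs] at this
  linarith

end Codes

/-! ### Matrix entries of the Weyl operators. -/

section WeylCodes

variable {d : ℕ} [NeZero d]

lemma shiftX_pow_apply (k : ℕ) (i j : ZMod d) :
    (shiftX d ^ k) i j = if i = j - k then 1 else 0 := by
  induction k generalizing i j with
  | zero => simp [Matrix.one_apply]
  | succ k ih =>
    rw [pow_succ, Matrix.mul_apply, Finset.sum_eq_single (j - 1)]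
    · rw [ih]
      simp only [shiftX, Matrix.of_apply, if_true, mul_one]
      congr 1
      rw [Nat.cast_succ, sub_sub, add_comm (1 : ZMod d)]
    · intro l _ hl
      simp [shiftX, hl]
    · simp

variable {ω : ℂ}

lemma weyl_apply (hω : ω ^ d = 1) (u : Alphabet d) (i j : ZMod d) :
    weyl ω u i j = if i = j - u.1 then AddChar.zmodChar d hω (u.2 * j) else 0 := by
  have h : AddChar.zmodChar d hω (u.2 * j) = (ω ^ j.val) ^ u.2.val := by
    rw [← AddChar.zmodChar_apply hω, ← AddChar.map_nsmul_eq_pow, nsmul_eq_mul,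
      ZMod.natCast_zmod_val]
  rw [weyl, clockZ, Matrix.diagonal_pow, Matrix.mul_diagonal, shiftX_pow_apply,
    ZMod.natCast_zmod_val, h]
  split_ifs <;> simp

/-- Shift part of `x`. -/
abbrev fstPart {n : ℕ} (x : Fin n → Alphabet d) : Idx d n := fun i => (x i).1

/-- Phase part of `x`. -/
abbrev sndPart {n : ℕ} (x : Fin n → Alphabet d) : Idx d n := fun i => (x i).2

lemma weylTensor_apply (hω : ω ^ d = 1) {n : ℕ} (x : Fin n → Alphabet d) (a b : Idx d n) :
    weylTensor ω x a b =
      if a = b - fstPart x then AddChar.zmodChar d hω (sndPart x ⬝ᵥ b) else 0 := by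
  simp only [weylTensor, Matrix.of_apply, weyl_apply hω]
  by_cases h : a = b - fstPart x
  · have hsum : ∀ f : Fin n → ZMod d, AddChar.zmodChar d hω (∑ i, f i) =
        ∏ i, AddChar.zmodChar d hω (f i) := fun f => by
      exact map_prod (AddChar.zmodChar d hω).toMonoidHom
        (fun i => Multiplicative.ofAdd (f i)) Finset.univ
    rw [if_pos h, dotProduct, hsum]
    refine Finset.prod_congr rfl fun i _ => ?_
    exact if_pos (congrFun h i)
  · rw [if_neg h]
    obtain ⟨i, hi⟩ := Function.ne_iff.1 h
    exact Finset.prod_eq_zero (Finset.mem_univ i) (if_neg hi)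

lemma star_zmodChar (hω : ω ^ d = 1) (t : ZMod d) :
    star (AddChar.zmodChar d hω t) = AddChar.zmodChar d hω (-t) :=
  (AddChar.map_neg_eq_conj _ _).symm

lemma weylTensor_isometry (hω : ω ^ d = 1) {n : ℕ} (x : Fin n → Alphabet d) :
    (weylTensor ω x).conjTranspose * weylTensor ω x = 1 := by
  ext l l'
  rw [Matrix.mul_apply, Finset.sum_eq_single (l' - fstPart x)]
  · simp only [Matrix.conjTranspose_apply, weylTensor_apply hω, if_true, sub_left_inj]
    by_cases h : l' = l
    · subst h
      rw [if_pos rfl, star_zmodChar, ← AddChar.map_add_eq_mul, neg_add_cancel,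
        AddChar.map_zero_eq_one, Matrix.one_apply_eq]
    · rw [if_neg h, star_zero, zero_mul, Matrix.one_apply_ne (Ne.symm h)]
  · intro k _ hk
    rw [weylTensor_apply hω x k l', if_neg hk, mul_zero]
  · simp

end WeylCodes

/-! ### Quadratic-phase bases and their translation by Weyl errors. -/

section PrimitiveRoot

variable {d : ℕ} [Fact d.Prime] {ω : ℂ}

/-- A nonzero c has an invertible coordinate c_i because d is prime; at c_i⁻¹ e_i the character
takes the value ω ≠ 1, so it is nontrivial and sums to zero. -/
lemma sum_zmodChar_dotProduct (hω : IsPrimitiveRoot ω d) {n : ℕ} (c : Idx d n) :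
    ∑ l : Idx d n, AddChar.zmodChar d hω.pow_eq_one (c ⬝ᵥ l) =
      if c = 0 then (d : ℂ) ^ n else 0 := by
  classical
  let ψ : AddChar (Idx d n) ℂ :=
    { toFun := fun l => AddChar.zmodChar d hω.pow_eq_one (c ⬝ᵥ l)
      map_zero_eq_one' := by simp
      map_add_eq_mul' := fun l l' => by rw [dotProduct_add, AddChar.map_add_eq_mul] }
  have hψ : ψ = 0 ↔ c = 0 := by
    constructor
    · intro h
      by_contra hc
      obtain ⟨i, hi⟩ := Function.ne_iff.1 hc
      have h1 : ψ (Pi.single i (c i)⁻¹) = 1 := by rw [h]; rfl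
      have h2 : ψ (Pi.single i (c i)⁻¹) = ω := by
        change AddChar.zmodChar d hω.pow_eq_one (c ⬝ᵥ Pi.single i (c i)⁻¹) = ω
        rw [dotProduct_single, mul_inv_cancel₀ hi, AddChar.zmodChar_apply]
        have : Fact (1 < d) := ⟨(Fact.out : d.Prime).one_lt⟩
        rw [ZMod.val_one, pow_one]
      exact hω.ne_one (Fact.out : d.Prime).one_lt (h2.symm.trans h1)
    · rintro rfl
      ext l
      change AddChar.zmodChar d hω.pow_eq_one (0 ⬝ᵥ l) = 1
      simp
  have := AddChar.sum_eq_ite ψ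
  simp only [hψ] at this
  refine this.trans ?_
  simp [ZMod.card]

/-- Different shifts leave a zero diagonal; equal shifts leave the full sum of a nontrivial
character. -/
lemma trace_weylTensor_eq_zero (hω : IsPrimitiveRoot ω d) {n : ℕ} {x y : Fin n → Alphabet d}
    (hxy : x ≠ y) :
    ((weylTensor ω x).conjTranspose * weylTensor ω y).trace = 0 := by
  have h1 : ∀ l, ((weylTensor ω x).conjTranspose * weylTensor ω y) l l =
      if fstPart x = fstPart y then
        AddChar.zmodChar d hω.pow_eq_one ((sndPart y - sndPart x) ⬝ᵥ l) else 0 := by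
    intro l
    rw [Matrix.mul_apply, Finset.sum_eq_single (l - fstPart y)]
    · simp only [Matrix.conjTranspose_apply, weylTensor_apply hω.pow_eq_one, if_true,
        sub_right_inj, eq_comm (a := fstPart y)]
      split_ifs
      · rw [star_zmodChar, ← AddChar.map_add_eq_mul, sub_dotProduct, neg_add_eq_sub]
      · simp
    · intro k _ hk
      rw [weylTensor_apply hω.pow_eq_one y k l, if_neg hk, mul_zero]
    · simp
  simp only [Matrix.trace, Matrix.diag_apply, h1]
  by_cases h : fstPart x = fstPart y
  · simp only [if_pos h]
    rw [sum_zmodChar_dotProduct hω, if_neg]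
    intro h2
    apply hxy
    funext i
    exact Prod.ext (congrFun h i) (congrFun (sub_eq_zero.1 h2) i).symm
  · simp [h]

/-- The unitary with entries `d^{-n/2} χ(lᵀ B l + j · l)`. -/
def quadBasis (hω : IsPrimitiveRoot ω d) {n : ℕ} (B : Matrix (Fin n) (Fin n) (ZMod d)) :
    Matrix (Idx d n) (Idx d n) ℂ :=
  Matrix.of fun l j => ((Real.sqrt (d ^ n) : ℝ) : ℂ)⁻¹ *
    AddChar.zmodChar d hω.pow_eq_one (l ⬝ᵥ B.mulVec l + j ⬝ᵥ l)

lemma quadBasis_isometry (hω : IsPrimitiveRoot ω d) {n : ℕ} (B : Matrix (Fin n) (Fin n) (ZMod d)) :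
    (quadBasis hω B).conjTranspose * quadBasis hω B = 1 := by
  have hd : (0 : ℝ) < d ^ n := by
    have := (Fact.out : d.Prime).pos
    positivity
  ext i j
  have h1 : ∀ l, star (quadBasis hω B l i) * quadBasis hω B l j =
      ((d : ℂ) ^ n)⁻¹ * AddChar.zmodChar d hω.pow_eq_one ((j - i) ⬝ᵥ l) := by
    intro l
    simp only [quadBasis, Matrix.of_apply]
    rw [star_mul', star_zmodChar, mul_mul_mul_comm, ← AddChar.map_add_eq_mul]
    congr 1
    · rw [Complex.star_def, map_inv₀, Complex.conj_ofReal, ← mul_inv,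
        ← Complex.ofReal_mul, Real.mul_self_sqrt hd.le]
      simp
    · congr 1
      rw [sub_dotProduct]
      ring
  rw [Matrix.mul_apply]
  simp only [Matrix.conjTranspose_apply, h1]
  rw [← Finset.mul_sum, sum_zmodChar_dotProduct hω]
  have hd' : (d : ℂ) ^ n ≠ 0 := by exact_mod_cast hd.ne'
  by_cases h : i = j
  · subst h
    simp [hd']
  · rw [if_neg (sub_ne_zero.2 (Ne.symm h)), mul_zero, Matrix.one_apply_ne h]

/-- The translation of the columns of `quadBasis B` under the error `y`. -/
def quadShift {n : ℕ} (B : Matrix (Fin n) (Fin n) (ZMod d)) (y : Fin n → Alphabet d) : Idx d n :=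
  sndPart y + (B + B.transpose).mulVec (fstPart y)

/-- Expanding the quadratic form at l + a, the part linear in l is ((B + Bᵀ)a)·l, which shifts the
index; the terms free of l form the phase. -/
lemma weylTensor_mul_quadBasis_apply (hω : IsPrimitiveRoot ω d) {n : ℕ}
    (B : Matrix (Fin n) (Fin n) (ZMod d))
    (y : Fin n → Alphabet d) (l j : Idx d n) :
    (weylTensor ω y * quadBasis hω B) l j =
      AddChar.zmodChar d hω.pow_eq_one (sndPart y ⬝ᵥ fstPart y +
        fstPart y ⬝ᵥ B.mulVec (fstPart y) + j ⬝ᵥ fstPart y) *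
        quadBasis hω B l (j + quadShift B y) := by
  rw [Matrix.mul_apply, Finset.sum_eq_single (l + fstPart y)]
  · rw [weylTensor_apply hω.pow_eq_one, if_pos (by rw [add_sub_cancel_right])]
    simp only [quadBasis, Matrix.of_apply]
    rw [mul_left_comm, mul_left_comm (AddChar.zmodChar d hω.pow_eq_one _),
      ← AddChar.map_add_eq_mul, ← AddChar.map_add_eq_mul]
    congr 2
    have h1 : fstPart y ⬝ᵥ B.mulVec l = B.transpose.mulVec (fstPart y) ⬝ᵥ l := by
      rw [Matrix.dotProduct_mulVec, Matrix.mulVec_transpose]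
    have h2 : l ⬝ᵥ B.mulVec (fstPart y) = B.mulVec (fstPart y) ⬝ᵥ l := dotProduct_comm _ _
    simp only [quadShift, Matrix.mulVec_add, dotProduct_add, add_dotProduct, Matrix.add_mulVec]
    rw [h1, h2]
    ring
  · intro k _ hk
    rw [weylTensor_apply hω.pow_eq_one, if_neg, zero_mul]
    intro h
    exact hk (by rw [h, sub_add_cancel])
  · simp

lemma conj_quadBasis_weylTensor_apply (hω : IsPrimitiveRoot ω d) {n : ℕ}
    (B : Matrix (Fin n) (Fin n) (ZMod d))
    (y : Fin n → Alphabet d) {i j : Idx d n} (h : i ≠ j + quadShift B y) :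
    ((quadBasis hω B).conjTranspose * weylTensor ω y * quadBasis hω B) i j = 0 := by
  rw [Matrix.mul_assoc, Matrix.mul_apply]
  simp only [weylTensor_mul_quadBasis_apply hω, mul_left_comm _ (AddChar.zmodChar d _ _)]
  rw [← Finset.mul_sum, ← Matrix.mul_apply, quadBasis_isometry, Matrix.one_apply_ne h, mul_zero]

/-- The syndrome of the error `y`. -/
def syndrome {n m : ℕ} (B : Matrix (Fin n) (Fin n) (ZMod d)) (T : Matrix (Fin m) (Fin n) (ZMod d))
    (y : Fin n → Alphabet d) : Fin m → ZMod d :=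
  T.mulVec (quadShift B y)

/-- Existence of a code that corrects the errors `z t`, one for each syndrome `t`. -/
theorem exists_weyl_code (hω : IsPrimitiveRoot ω d) {n m : ℕ} (B : Matrix (Fin n) (Fin n) (ZMod d))
    (T : Matrix (Fin m) (Fin n) (ZMod d))
    {𝒜 : Matrix (Idx d n) (Idx d n) ℂ →ₗ[ℂ] Matrix (Idx d n) (Idx d n) ℂ} (h𝒜 : IsTPCP 𝒜)
    {P : (Fin n → Alphabet d) → ℝ} (hP : IsAssociatedDistribution ω 𝒜 P)
    (z : (Fin m → ZMod d) → Fin n → Alphabet d) :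
    ∃ (C : Submodule ℂ (EuclideanSpace ℂ (Idx d n)))
      (ℛ : Matrix (Idx d n) (Idx d n) ℂ →ₗ[ℂ] Matrix (Idx d n) (Idx d n) ℂ),
      IsTPCP ℛ ∧ d ^ n ≤ 2 * d ^ m * Module.finrank ℂ C ∧
      1 - 2 * ∑ y with z (syndrome B T y) ≠ y, P y ≤ minFidelity C (ℛ ∘ₗ 𝒜) := by
  obtain ⟨A, a, hK, hA, hPa⟩ := hP
  obtain ⟨C, ℛ, h1, h2, h3⟩ := exists_code (quadBasis_isometry hω B) (fun j => T.mulVec j)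
    (syndrome B T) (weylTensor_isometry hω.pow_eq_one)
    (fun y i j hij => conj_quadBasis_weylTensor_apply hω B y (by
      rintro rfl
      exact hij (Matrix.mulVec_add _ _ _)))
    (fun y y' h => trace_weylTensor_eq_zero hω h) hA hK h𝒜.tracePreserving z
  refine ⟨C, ℛ, h1, ?_, ?_⟩
  · simpa [ZMod.card] using h2
  · simpa only [hPa] using h3

end PrimitiveRoot

/-! ### Random choice of B and T, and the union bound for least-rank decoding. -/

section RandomCodes

lemma card_fiber_mul_card {G H : Type*} [AddGroup G] [AddGroup H] [Fintype G] [Fintype H]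
    [DecidableEq H] (f : G →+ H) (hf : Function.Surjective f) (c : H) :
    (Finset.univ.filter fun x => f x = c).card * Fintype.card H = Fintype.card G := by
  classical
  rw [← Finset.card_univ (α := G), Finset.card_eq_sum_card_fiberwise (s := Finset.univ) (f := f)
    (t := Finset.univ) (by simp)]
  rw [Finset.sum_congr rfl fun b _ => AddMonoidHom.card_fiber_eq_of_mem_range f
    (hf b) (hf c)]
  rw [Finset.sum_const, Finset.card_univ, smul_eq_mul, mul_comm]

variable {d : ℕ} [Fact d.Prime]

/-- T ↦ Tw is a surjective homomorphism when w ≠ 0, so its fibres have equal size. -/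
lemma card_mulVec_eq_zero {n m : ℕ} {w : Fin n → ZMod d} (hw : w ≠ 0) :
    (Finset.univ.filter fun T : Matrix (Fin m) (Fin n) (ZMod d) => T.mulVec w = 0).card * d ^ m =
      Fintype.card (Matrix (Fin m) (Fin n) (ZMod d)) := by
  obtain ⟨i, hi⟩ := Function.ne_iff.1 hw
  let f : Matrix (Fin m) (Fin n) (ZMod d) →+ (Fin m → ZMod d) :=
    { toFun := fun T => T.mulVec w
      map_zero' := Matrix.zero_mulVec w
      map_add' := fun S T => Matrix.add_mulVec S T w }
  have hf : Function.Surjective f := by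
    intro v
    refine ⟨Matrix.vecMulVec v (Pi.single i (w i)⁻¹), ?_⟩
    change (Matrix.vecMulVec v (Pi.single i (w i)⁻¹)).mulVec w = v
    rw [Matrix.vecMulVec_mulVec, single_dotProduct, inv_mul_cancel₀ hi]
    simp
  have := card_fiber_mul_card f hf 0
  rw [Fintype.card_fun, ZMod.card, Fintype.card_fin] at this
  exact this

/-- A zero shift part leaves the nonzero phase part, which never vanishes. Otherwise a_i ≠ 0 for
some i, and the coordinates of (B + Bᵀ)a other than the i-th are jointly uniform. One coordinate has
to be given up: for d = 2 the matrix B + Bᵀ is alternating, so a·(B + Bᵀ)a = 0. -/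
lemma card_quadShift_eq_zero_le {n : ℕ} {y : Fin n → Alphabet d} (hy : y ≠ 0) :
    (Finset.univ.filter fun B : Matrix (Fin n) (Fin n) (ZMod d) => quadShift B y = 0).card *
      d ^ (n - 1) ≤ Fintype.card (Matrix (Fin n) (Fin n) (ZMod d)) := by
  by_cases ha : fstPart y = 0
  · have hb : sndPart y ≠ 0 := fun hb => hy <| by
      funext i
      exact Prod.ext (congrFun ha i) (congrFun hb i)
    rw [Finset.filter_false_of_mem]
    · simp
    · intro B _
      rwa [quadShift, ha, Matrix.mulVec_zero, add_zero]
  · obtain ⟨i, hi⟩ := Function.ne_iff.1 ha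
    let f : Matrix (Fin n) (Fin n) (ZMod d) →+ ({l : Fin n // l ≠ i} → ZMod d) :=
      { toFun := fun B l => (B + B.transpose).mulVec (fstPart y) l
        map_zero' := by ext; simp
        map_add' := fun B B' => by
          ext l
          simp only [Matrix.transpose_add, Matrix.add_mulVec, Pi.add_apply]
          ring }
    have hf : Function.Surjective f := by
      intro v
      -- Support in column i off the diagonal: the transpose then only affects row i, which is
      -- discarded.
      refine ⟨Matrix.of fun k l => if h : k ≠ i then
        (if l = i then v ⟨k, h⟩ * (fstPart y i)⁻¹ else 0) else 0, ?_⟩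
      ext l
      simp only [f, AddMonoidHom.coe_mk, ZeroHom.coe_mk, Matrix.mulVec, dotProduct,
        Matrix.add_apply, Matrix.of_apply,
        Matrix.transpose_apply]
      rw [Finset.sum_eq_single i]
      · rw [dif_pos l.2, if_pos rfl, dif_neg (by simp), add_zero, mul_assoc, inv_mul_cancel₀ hi,
          mul_one]
      · intro k _ hk
        rw [dif_pos l.2, if_neg hk, dif_pos hk, if_neg l.2, add_zero, zero_mul]
      · simp
    have hcard := card_fiber_mul_card f hf fun l => - sndPart y l
    have hH : Fintype.card ({l : Fin n // l ≠ i} → ZMod d) = d ^ (n - 1) := by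
      simp [ZMod.card, Fintype.card_subtype_compl]
    rw [hH] at hcard
    rw [← hcard]
    refine Nat.mul_le_mul_right _ (Finset.card_le_card ?_)
    intro B hB
    simp only [Finset.mem_filter, Finset.mem_univ, true_and] at hB ⊢
    funext l
    exact eq_neg_of_add_eq_zero_right (congrFun hB l)

/-- Either the index shift of y already vanishes, with probability at most d^{-(n-1)} ≤ d^{-m}, or T
kills a nonzero vector, with probability d^{-m}. -/
lemma card_syndrome_eq_zero_le {n m : ℕ} (hm : m + 1 ≤ n) {y : Fin n → Alphabet d} (hy : y ≠ 0) :
    ((Finset.univ.filter fun p : Matrix (Fin n) (Fin n) (ZMod d) ×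
      Matrix (Fin m) (Fin n) (ZMod d) => syndrome p.1 p.2 y = 0).card : ℝ) ≤
      Fintype.card (Matrix (Fin n) (Fin n) (ZMod d) × Matrix (Fin m) (Fin n) (ZMod d)) *
        (2 * ((d : ℝ) ^ m)⁻¹) := by
  have hd : (0 : ℝ) < d := by exact_mod_cast (Fact.out : d.Prime).pos
  have hd1 : (1 : ℝ) ≤ d := by exact_mod_cast (Fact.out : d.Prime).one_lt.le
  set b : ℝ := (Fintype.card (Matrix (Fin n) (Fin n) (ZMod d)) : ℝ) with hb
  set t : ℝ := (Fintype.card (Matrix (Fin m) (Fin n) (ZMod d)) : ℝ) with ht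
  have hB : ((Finset.univ.filter fun B : Matrix (Fin n) (Fin n) (ZMod d) =>
      quadShift B y = 0).card : ℝ) ≤ b * ((d : ℝ) ^ m)⁻¹ := by
    rw [← div_eq_mul_inv, le_div_iff₀ (by positivity)]
    calc _ ≤ ((Finset.univ.filter fun B : Matrix (Fin n) (Fin n) (ZMod d) =>
          quadShift B y = 0).card : ℝ) * (d : ℝ) ^ (n - 1) := by
          gcongr
          omega
      _ ≤ b := by
        rw [hb]
        exact_mod_cast card_quadShift_eq_zero_le hy
  have hT : ∀ B : Matrix (Fin n) (Fin n) (ZMod d),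
      ((Finset.univ.filter fun T : Matrix (Fin m) (Fin n) (ZMod d) =>
        syndrome B T y = 0).card : ℝ) ≤
        (if quadShift B y = 0 then t else 0) + t * ((d : ℝ) ^ m)⁻¹ := by
    intro B
    by_cases h : quadShift B y = 0
    · rw [if_pos h]
      have : ((Finset.univ.filter fun T : Matrix (Fin m) (Fin n) (ZMod d) =>
          syndrome B T y = 0).card : ℝ) ≤ t := by
        rw [ht]
        exact_mod_cast Finset.card_le_univ _
      have : 0 ≤ t * ((d : ℝ) ^ m)⁻¹ := by positivity
      linarith
    · rw [if_neg h, zero_add, ← div_eq_mul_inv, le_div_iff₀ (by positivity)]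
      rw [ht]
      exact_mod_cast (card_mulVec_eq_zero (m := m) h).le
  have hsplit : ((Finset.univ.filter fun p : Matrix (Fin n) (Fin n) (ZMod d) ×
      Matrix (Fin m) (Fin n) (ZMod d) => syndrome p.1 p.2 y = 0).card : ℝ) =
      ∑ B : Matrix (Fin n) (Fin n) (ZMod d), ((Finset.univ.filter
        fun T : Matrix (Fin m) (Fin n) (ZMod d) => syndrome B T y = 0).card : ℝ) := by
    simp only [Finset.card_filter, Fintype.sum_prod_type, Nat.cast_sum]
  rw [hsplit]
  refine (Finset.sum_le_sum fun B _ => hT B).trans ?_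
  rw [Finset.sum_add_distrib, ← Finset.sum_filter, Finset.sum_const, Finset.sum_const,
    Finset.card_univ, nsmul_eq_mul, nsmul_eq_mul, Fintype.card_prod, Nat.cast_mul, ← hb, ← ht]
  have : ((Finset.univ.filter fun B : Matrix (Fin n) (Fin n) (ZMod d) =>
      quadShift B y = 0).card : ℝ) * t ≤ b * ((d : ℝ) ^ m)⁻¹ * t := by gcongr
  linarith

lemma syndrome_sub {n m : ℕ} (B : Matrix (Fin n) (Fin n) (ZMod d))
    (T : Matrix (Fin m) (Fin n) (ZMod d)) (y y' : Fin n → Alphabet d) :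
    syndrome B T (y - y') = syndrome B T y - syndrome B T y' := by
  have h1 : fstPart (y - y') = fstPart y - fstPart y' := rfl
  have h2 : sndPart (y - y') = sndPart y - sndPart y' := rfl
  rw [syndrome, syndrome, syndrome, ← Matrix.mulVec_sub, quadShift, quadShift, quadShift, h1, h2,
    Matrix.mulVec_sub]
  congr 1
  abel

/-- For every rank function `r` there are syndromes for which decoding to an error of least rank
fails with probability bounded by the number of errors of no larger rank. -/
theorem exists_syndrome_decoder {n m : ℕ} (hm : m + 1 ≤ n) (P : (Fin n → Alphabet d) → ℝ)
    (hP : ∀ y, 0 ≤ P y) (r : (Fin n → Alphabet d) → ℝ) :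
    ∃ (B : Matrix (Fin n) (Fin n) (ZMod d)) (T : Matrix (Fin m) (Fin n) (ZMod d))
      (z : (Fin m → ZMod d) → Fin n → Alphabet d),
      ∑ y with z (syndrome B T y) ≠ y, P y ≤
        ∑ y, P y * min 1 (2 * ((d : ℝ) ^ m)⁻¹ *
          (Finset.univ.filter fun y' => r y' ≤ r y).card) := by
  have hz : ∀ p : Matrix (Fin n) (Fin n) (ZMod d) × Matrix (Fin m) (Fin n) (ZMod d),
      ∃ z : (Fin m → ZMod d) → Fin n → Alphabet d, ∀ y,
        syndrome p.1 p.2 (z (syndrome p.1 p.2 y)) = syndrome p.1 p.2 y ∧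
          r (z (syndrome p.1 p.2 y)) ≤ r y := by
    intro p
    have : ∀ t, ∃ y, ∀ y', syndrome p.1 p.2 y' = t → syndrome p.1 p.2 y = t ∧ r y ≤ r y' := by
      intro t
      by_cases hne : (Finset.univ.filter fun y => syndrome p.1 p.2 y = t).Nonempty
      · obtain ⟨y, hy, hmin⟩ := Finset.exists_min_image _ r hne
        exact ⟨y, fun y' hy' => ⟨by simpa using hy, hmin y' (by simpa using hy')⟩⟩
      -- A syndrome that no error attains; the value is irrelevant.
      · refine ⟨0, fun y' hy' => absurd ⟨y', by simpa using hy'⟩ hne⟩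
    choose z hz using this
    exact ⟨z, fun y => hz _ y rfl⟩
  choose z hz using hz
  set M : ℝ :=
    (Fintype.card (Matrix (Fin n) (Fin n) (ZMod d) × Matrix (Fin m) (Fin n) (ZMod d)) : ℝ)
    with hM
  have hbad : ∀ y, ((Finset.univ.filter fun p => z p (syndrome p.1 p.2 y) ≠ y).card : ℝ) ≤
      M * min 1 (2 * ((d : ℝ) ^ m)⁻¹ * (Finset.univ.filter fun y' => r y' ≤ r y).card) := by
    intro y
    rw [mul_min_of_nonneg _ _ (by positivity), mul_one, le_min_iff]
    constructor
    · rw [hM]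
      exact_mod_cast Finset.card_le_univ _
    -- If y is decoded wrongly, the decoded error is another one of no larger rank with the same
    -- syndrome, so the difference has syndrome zero.
    · have hsub : (Finset.univ.filter fun p => z p (syndrome p.1 p.2 y) ≠ y) ⊆
          ((Finset.univ.filter fun y' => r y' ≤ r y).erase y).biUnion fun y' =>
            Finset.univ.filter fun p => syndrome p.1 p.2 (y' - y) = 0 := by
        intro p hp
        simp only [Finset.mem_filter, Finset.mem_univ, true_and] at hp
        simp only [Finset.mem_biUnion, Finset.mem_erase, Finset.mem_filter, Finset.mem_univ,
          true_and]
        exact ⟨_, ⟨hp, (hz p y).2⟩, by rw [syndrome_sub, (hz p y).1, sub_self]⟩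
      have h1 : ((Finset.univ.filter fun p => z p (syndrome p.1 p.2 y) ≠ y).card : ℝ) ≤
          ∑ y' ∈ (Finset.univ.filter fun y' => r y' ≤ r y).erase y,
            ((Finset.univ.filter fun p : Matrix (Fin n) (Fin n) (ZMod d) ×
              Matrix (Fin m) (Fin n) (ZMod d) => syndrome p.1 p.2 (y' - y) = 0).card : ℝ) := by
        exact_mod_cast (Finset.card_le_card hsub).trans Finset.card_biUnion_le
      refine h1.trans ((Finset.sum_le_sum fun y' hy' => card_syndrome_eq_zero_le hm
        (sub_ne_zero.2 (Finset.ne_of_mem_erase hy'))).trans ?_)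
      rw [Finset.sum_const, nsmul_eq_mul, ← hM, mul_comm, mul_assoc]
      have hc : (((Finset.univ.filter fun y' => r y' ≤ r y).erase y).card : ℝ) ≤
          (Finset.univ.filter fun y' => r y' ≤ r y).card := by
        exact_mod_cast Finset.card_le_card (Finset.erase_subset _ _)
      gcongr
  -- Average over all pairs (B, T); some pair does no worse than the mean.
  have hsum : ∑ p, ∑ y with z p (syndrome p.1 p.2 y) ≠ y, P y ≤
      ∑ _p : Matrix (Fin n) (Fin n) (ZMod d) × Matrix (Fin m) (Fin n) (ZMod d),
        ∑ y, P y * min 1 (2 * ((d : ℝ) ^ m)⁻¹ *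
          (Finset.univ.filter fun y' => r y' ≤ r y).card) := by
    rw [Finset.sum_const, Finset.card_univ, nsmul_eq_mul, ← hM, Finset.mul_sum]
    simp only [Finset.sum_filter]
    rw [Finset.sum_comm]
    refine Finset.sum_le_sum fun y _ => ?_
    rw [← Finset.sum_filter, Finset.sum_const, nsmul_eq_mul, mul_left_comm, mul_comm]
    exact mul_le_mul_of_nonneg_left (hbad y) (hP y)
  obtain ⟨p, -, hp⟩ := Finset.exists_le_of_sum_le Finset.univ_nonempty hsum
  exact ⟨p.1, p.2, z p, hp⟩

end RandomCodes

/-! ### Continuity of the objective, attainment of its minimum, and stability near balance. -/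

section Objective

variable {α : Type} [Fintype α]

/-- The conditional entropy of the second letter given the first, written so that it is continuous in `Q`. -/
def pairEntropy (d : ℕ) (Q : α × α → ℝ) : ℝ :=
  (∑ u, ∑ v, Real.negMulLog (Q (u, v)) - ∑ u, Real.negMulLog (marginal₁ Q u)) / Real.log d

lemma marginal₁_nonneg {Q : α × α → ℝ} (hQ : ∀ p, 0 ≤ Q p) (u : α) : 0 ≤ marginal₁ Q u :=
  Finset.sum_nonneg fun _ _ => hQ _

lemma eq_zero_of_marginal₁_eq_zero {Q : α × α → ℝ} (hQ : ∀ p, 0 ≤ Q p) {u : α}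
    (h : marginal₁ Q u = 0) (v : α) : Q (u, v) = 0 :=
  (Finset.sum_eq_zero_iff_of_nonneg fun _ _ => hQ _).1 h v (Finset.mem_univ v)

lemma pairEntropy_eq (d : ℕ) {Q : α × α → ℝ} (hQ : ∀ p, 0 ≤ Q p) :
    pairEntropy d Q = -∑ u, ∑ v, Q (u, v) * Real.logb d (condProb Q u v) := by
  have h : ∀ u v, Q (u, v) * Real.logb d (condProb Q u v) =
      -(Real.negMulLog (Q (u, v)) + Q (u, v) * Real.log (marginal₁ Q u)) / Real.log d := by
    intro u v
    by_cases h0 : Q (u, v) = 0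
    · simp [h0]
    · have hm : marginal₁ Q u ≠ 0 := fun hm => h0 (eq_zero_of_marginal₁_eq_zero hQ hm v)
      rw [Real.logb, condProb, Real.log_div h0 hm, Real.negMulLog]
      ring
  simp only [h, ← Finset.sum_div, Finset.sum_neg_distrib, Finset.sum_add_distrib]
  have h2 : ∀ u, ∑ v, Q (u, v) * Real.log (marginal₁ Q u) =
      -Real.negMulLog (marginal₁ Q u) := by
    intro u
    rw [← Finset.sum_mul, Real.negMulLog, marginal₁]
    ring
  simp only [h2, Finset.sum_neg_distrib, pairEntropy]
  ring

lemma condEntropy_eq_pairEntropy (d : ℕ) {Q : α × α → ℝ} (hQ : ∀ p, 0 ≤ Q p) :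
    condEntropy d (condProb Q) (marginal₁ Q) = pairEntropy d Q := by
  rw [pairEntropy_eq d hQ, condEntropy, Finset.sum_filter]
  congr 1
  refine Finset.sum_congr rfl fun u _ => ?_
  split_ifs with hu
  · refine Finset.sum_congr rfl fun v _ => ?_
    rw [condProb, mul_div_cancel₀ _ hu.ne']
  · have h0 : marginal₁ Q u = 0 := le_antisymm (not_lt.1 hu) (marginal₁_nonneg hQ u)
    simp [eq_zero_of_marginal₁_eq_zero hQ h0]

lemma continuous_marginal₁ (u : α) : Continuous fun Q : α × α → ℝ => marginal₁ Q u := by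
  unfold marginal₁
  fun_prop

lemma continuous_marginal₂ (u : α) : Continuous fun Q : α × α → ℝ => marginal₂ Q u := by
  unfold marginal₂
  fun_prop

lemma continuous_pairEntropy (d : ℕ) : Continuous fun Q : α × α → ℝ => pairEntropy d Q := by
  unfold pairEntropy
  have h1 := fun u => Real.continuous_negMulLog.comp (continuous_marginal₁ (α := α) u)
  have h2 := fun u v : α => Real.continuous_negMulLog.comp
    (continuous_apply (A := fun _ : α × α => ℝ) (u, v))
  exact ((continuous_finsetSum _ fun u _ => continuous_finsetSum _ fun v _ => h2 u v).sub
    (continuous_finsetSum _ fun u _ => h1 u)).div_const _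

/-- The objective on the distributions whose support is contained in that of `P`. -/
def realObjective (d : ℕ) (R : ℝ) (P : α → α → ℝ) (Q : α × α → ℝ) : ℝ :=
  -pairEntropy d Q - ∑ u, ∑ v, Q (u, v) * Real.logb d (P u v) +
    max (1 - pairEntropy d Q - R) 0

lemma continuous_realObjective (d : ℕ) (R : ℝ) (P : α → α → ℝ) :
    Continuous (realObjective d R P) := by
  unfold realObjective
  have := continuous_pairEntropy (α := α) d
  fun_prop

lemma EReal_sum_ne_bot {κ : Type*} (s : Finset κ) (f : κ → EReal) (hf : ∀ i ∈ s, f i ≠ ⊥) :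
    ∑ i ∈ s, f i ≠ ⊥ := by
  classical
  induction s using Finset.induction_on with
  | empty => simp
  | insert i s hi ih =>
    rw [Finset.sum_insert hi]
    exact EReal.add_ne_bot_iff.2 ⟨hf i (Finset.mem_insert_self i s),
      ih fun j hj => hf j (Finset.mem_insert_of_mem hj)⟩

lemma EReal_sum_eq_top {κ : Type*} (s : Finset κ) (f : κ → EReal) (hf : ∀ i ∈ s, f i ≠ ⊥)
    {i : κ} (hi : i ∈ s) (h : f i = ⊤) : ∑ i ∈ s, f i = ⊤ := by
  classical
  rw [← Finset.add_sum_erase s f hi, h]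
  exact EReal.top_add_of_ne_bot (EReal_sum_ne_bot _ _ fun j hj => hf j (Finset.mem_of_mem_erase hj))

lemma EReal_coe_sum {κ : Type*} (s : Finset κ) (f : κ → ℝ) :
    ((∑ i ∈ s, f i : ℝ) : EReal) = ∑ i ∈ s, (f i : EReal) := by
  classical
  induction s using Finset.induction_on with
  | empty => simp
  | insert i s hi ih => rw [Finset.sum_insert hi, Finset.sum_insert hi, EReal.coe_add, ih]

lemma divTerm_ne_bot (d : ℕ) (q a b : ℝ) : divTerm d q a b ≠ ⊥ := by
  unfold divTerm
  split_ifs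
  · exact EReal.zero_ne_bot
  · exact top_ne_bot
  · exact EReal.coe_ne_bot _

/-- One summand is ⊤. No summand is ⊥, which has to be checked because ⊥ would absorb it. -/
lemma objective_eq_top {d : ℕ} {R : ℝ} {P : α → α → ℝ} {Q : α × α → ℝ} (hQ : ∀ p, 0 ≤ Q p)
    {u v : α} (h : Q (u, v) ≠ 0) (hP : P u v = 0) : objective d R P Q = ⊤ := by
  have hu : 0 < marginal₁ Q u := lt_of_le_of_ne (marginal₁_nonneg hQ u) fun h0 =>
    h (eq_zero_of_marginal₁_eq_zero hQ h0.symm v)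
  have h1 : condDiv d Q P = ⊤ := by
    unfold condDiv
    refine EReal_sum_eq_top _ _ (fun u _ => EReal_sum_ne_bot _ _ fun v _ => divTerm_ne_bot _ _ _ _)
      (i := u) (by simp [hu]) ?_
    refine EReal_sum_eq_top _ _ (fun v _ => divTerm_ne_bot _ _ _ _) (Finset.mem_univ v) ?_
    simp [divTerm, h, hP]
  rw [objective, h1]
  exact EReal.top_add_coe _

/-- On the support of P no summand is infinite and the logarithm of the quotient splits. The real
form is continuous on the whole space, as compactness arguments require. -/
lemma objective_eq_realObjective {d : ℕ} {R : ℝ} {P : α → α → ℝ} {Q : α × α → ℝ}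
    (hQ : ∀ p, 0 ≤ Q p) (hP : ∀ u v, P u v = 0 → Q (u, v) = 0) :
    objective d R P Q = (realObjective d R P Q : EReal) := by
  have h1 : condDiv d Q P =
      ((-pairEntropy d Q - ∑ u, ∑ v, Q (u, v) * Real.logb d (P u v) : ℝ) : EReal) := by
    have hterm : ∀ u v, divTerm d (Q (u, v)) (condProb Q u v) (P u v) =
        ((Q (u, v) * Real.logb d (condProb Q u v) - Q (u, v) * Real.logb d (P u v) : ℝ) :
          EReal) := by
      intro u v
      by_cases h0 : Q (u, v) = 0
      · simp [divTerm, h0]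
      · have hp : P u v ≠ 0 := fun hp => h0 (hP u v hp)
        have hm : marginal₁ Q u ≠ 0 := fun hm => h0 (eq_zero_of_marginal₁_eq_zero hQ hm v)
        have hc : condProb Q u v ≠ 0 := div_ne_zero h0 hm
        rw [divTerm, if_neg h0, if_neg hp, Real.logb_div hc hp, mul_sub]
    rw [condDiv, pairEntropy_eq d hQ, neg_neg]
    simp only [hterm, ← EReal_coe_sum]
    congr 1
    rw [Finset.sum_filter, ← Finset.sum_sub_distrib]
    refine Finset.sum_congr rfl fun u _ => ?_
    split_ifs with hu
    · rw [Finset.sum_sub_distrib]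
    · have h0 : marginal₁ Q u = 0 := le_antisymm (not_lt.1 hu) (marginal₁_nonneg hQ u)
      simp [eq_zero_of_marginal₁_eq_zero hQ h0]
  rw [objective, h1, condEntropy_eq_pairEntropy d hQ, ← EReal.coe_add]
  rfl

/-- Distributions on pairs that are absolutely continuous with respect to `P`. -/
def feasible (P : α → α → ℝ) : Set (α × α → ℝ) :=
  {Q | IsProb Q ∧ ∀ u v, P u v = 0 → Q (u, v) = 0}

lemma isCompact_feasible (P : α → α → ℝ) : IsCompact (feasible P) := by
  have hcl : IsClosed {Q : α × α → ℝ | ∀ u v, P u v = 0 → Q (u, v) = 0} := by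
    simp only [Set.ofPred_forall]
    exact isClosed_iInter fun u => isClosed_iInter fun v => isClosed_iInter fun _ =>
      isClosed_eq (continuous_apply _) continuous_const
  exact (isCompact_stdSimplex ℝ (α × α)).inter_right hcl

lemma isClosed_balanced : IsClosed {Q : α × α → ℝ | marginal₁ Q = marginal₂ Q} := by
  refine isClosed_eq (continuous_pi fun u => continuous_marginal₁ u)
    (continuous_pi fun u => continuous_marginal₂ u)

/-- The minimum defining the exponent is attained. -/
theorem isLeast_exponent [Nonempty α] (d : ℕ) (R : ℝ) (P : α → α → ℝ) :
    IsLeast (objectiveValues d R P) (exponent d R P) := by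
  suffices h : ∃ m, IsLeast (objectiveValues d R P) m by
    obtain ⟨m, hm⟩ := h
    rwa [exponent, hm.csInf_eq]
  rcases (feasible P ∩ {Q | marginal₁ Q = marginal₂ Q}).eq_empty_or_nonempty with he | hne
  -- With no balanced feasible distribution the objective is constantly ⊤, and the uniform
  -- distribution attains it.
  · have htop : ∀ Q ∈ {Q : α × α → ℝ | IsProb Q ∧ marginal₁ Q = marginal₂ Q},
        objective d R P Q = ⊤ := by
      rintro Q ⟨hQ, hb⟩
      by_contra hnt
      refine (Set.mem_empty_iff_false Q).1 (he ▸ ⟨⟨hQ, fun u v hP => ?_⟩, hb⟩)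
      by_contra h0
      exact hnt (objective_eq_top hQ.1 h0 hP)
    have hcard : (0 : ℝ) < Fintype.card α := by exact_mod_cast Fintype.card_pos
    let U : α × α → ℝ := fun _ => ((Fintype.card α : ℝ) * Fintype.card α)⁻¹
    have hU : IsProb U ∧ marginal₁ U = marginal₂ U := by
      refine ⟨⟨fun _ => by positivity, ?_⟩, rfl⟩
      simp only [U, Finset.sum_const, Finset.card_univ, Fintype.card_prod, nsmul_eq_mul]
      push_cast
      field_simp
    refine ⟨⊤, ⟨U, hU, htop U hU⟩, ?_⟩
    rintro _ ⟨Q, hQ, rfl⟩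
    rw [htop Q hQ]
  · obtain ⟨Q, ⟨hQ, hb⟩, hmin⟩ := ((isCompact_feasible P).inter_right
      isClosed_balanced).exists_isMinOn hne (continuous_realObjective d R P).continuousOn
    refine ⟨objective d R P Q, ⟨Q, ⟨hQ.1, hb⟩, rfl⟩, ?_⟩
    rintro _ ⟨Q', ⟨hQ', hb'⟩, rfl⟩
    by_cases hf : ∀ u v, P u v = 0 → Q' (u, v) = 0
    · rw [objective_eq_realObjective hQ.1.1 hQ.2, objective_eq_realObjective hQ'.1 hf]
      exact EReal.coe_le_coe_iff.2 (hmin ⟨⟨hQ', hf⟩, hb'⟩)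
    · push Not at hf
      obtain ⟨u, v, hP, h0⟩ := hf
      rw [objective_eq_top hQ'.1 h0 hP]
      exact le_top

/-- The objective exceeds any number below the exponent on nearly balanced distributions. -/
theorem exists_gap {d : ℕ} {R : ℝ} {P : α → α → ℝ} {E₀ : ℝ} (hE : (E₀ : EReal) < exponent d R P) :
    ∃ δ > 0, ∀ Q ∈ feasible P, ∑ u, |marginal₁ Q u - marginal₂ Q u| < δ →
      E₀ < realObjective d R P Q := by
  -- On this compact set of violators the imbalance of the marginals attains a minimum, which is
  -- positive since a balanced violator would contradict E₀ < exponent; it serves as δ.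
  let K := feasible P ∩ {Q | realObjective d R P Q ≤ E₀}
  have hK : IsCompact K := (isCompact_feasible P).inter_right
    (isClosed_le (continuous_realObjective d R P) continuous_const)
  have hcont : Continuous fun Q : α × α → ℝ => ∑ u, |marginal₁ Q u - marginal₂ Q u| :=
    continuous_finsetSum _ fun u _ => ((continuous_marginal₁ u).sub (continuous_marginal₂ u)).abs
  rcases K.eq_empty_or_nonempty with he | hne
  · refine ⟨1, one_pos, fun Q hQ _ => ?_⟩
    by_contra h
    exact (Set.mem_empty_iff_false Q).1 (he ▸ ⟨hQ, not_lt.1 h⟩)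
  · obtain ⟨Q, ⟨hQ, hQE⟩, hmin⟩ := hK.exists_isMinOn hne hcont.continuousOn
    refine ⟨∑ u, |marginal₁ Q u - marginal₂ Q u|, ?_, fun Q' hQ' hlt => ?_⟩
    · refine lt_of_le_of_ne (Finset.sum_nonneg fun _ _ => abs_nonneg _) fun h0 => ?_
      have hb : marginal₁ Q = marginal₂ Q := by
        funext u
        have := (Finset.sum_eq_zero_iff_of_nonneg fun _ _ => abs_nonneg _).1 h0.symm u
          (Finset.mem_univ u)
        exact sub_eq_zero.1 (abs_eq_zero.1 this)
      have h1 : exponent d R P ≤ objective d R P Q := sInf_le ⟨Q, ⟨hQ.1, hb⟩, rfl⟩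
      rw [objective_eq_realObjective hQ.1.1 hQ.2] at h1
      exact absurd (hE.trans_le (h1.trans (EReal.coe_le_coe_iff.2 hQE))) (lt_irrefl _)
    · by_contra h
      exact absurd (hmin ⟨hQ', not_lt.1 h⟩) (not_le.2 hlt)

end Objective

/-! ### Transition types and the polynomial bound on the sum of d^{-nH}. -/

section Types

set_option linter.unusedSectionVars false

variable {α : Type} [Fintype α] [DecidableEq α]

/-- The number of transitions `u → v` in `x`. -/
def pairCount {n : ℕ} (x : Fin (n + 1) → α) (q : α × α) : ℕ :=
  (Finset.univ.filter fun j : Fin n => (x j.castSucc, x j.succ) = q).card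

/-- The empirical distribution of the transitions of `x`. -/
def pairType {n : ℕ} (x : Fin (n + 1) → α) (q : α × α) : ℝ := pairCount x q / n

lemma sum_pairCount_mul {n : ℕ} (x : Fin (n + 1) → α) (f : α × α → ℝ) :
    ∑ q, pairCount x q * f q = ∑ j : Fin n, f (x j.castSucc, x j.succ) := by
  simp only [pairCount, Finset.card_filter, Nat.cast_sum, Finset.sum_mul]
  rw [Finset.sum_comm]
  refine Finset.sum_congr rfl fun j _ => ?_
  simp

lemma sum_transitions_eq {n : ℕ} (hn : 0 < n) (x : Fin (n + 1) → α) (f : α → α → ℝ) :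
    ∑ j : Fin n, f (x j.castSucc) (x j.succ) = n * ∑ u, ∑ v, pairType x (u, v) * f u v := by
  have hn' : (n : ℝ) ≠ 0 := by exact_mod_cast hn.ne'
  rw [← sum_pairCount_mul x fun q => f q.1 q.2, Fintype.sum_prod_type, Finset.mul_sum]
  refine Finset.sum_congr rfl fun u _ => ?_
  rw [Finset.mul_sum]
  refine Finset.sum_congr rfl fun v _ => ?_
  rw [pairType]
  field_simp

lemma pairType_nonneg {n : ℕ} (x : Fin (n + 1) → α) (q : α × α) : 0 ≤ pairType x q := by
  unfold pairType
  positivity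

lemma isProb_pairType {n : ℕ} (hn : 0 < n) (x : Fin (n + 1) → α) : IsProb (pairType x) := by
  refine ⟨pairType_nonneg x, ?_⟩
  have hn' : (n : ℝ) ≠ 0 := by exact_mod_cast hn.ne'
  have h := sum_transitions_eq hn x fun _ _ => 1
  simp only [Finset.sum_const, Finset.card_univ, Fintype.card_fin, nsmul_eq_mul, mul_one] at h
  rw [Fintype.sum_prod_type]
  exact mul_left_cancel₀ hn' (h.symm.trans (mul_one _).symm)

lemma pairType_transition_pos {n : ℕ} (x : Fin (n + 1) → α) (j : Fin n) :
    0 < pairType x (x j.castSucc, x j.succ) := by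
  have hn : 0 < n := Fin.pos j
  refine div_pos ?_ (by exact_mod_cast hn)
  exact_mod_cast Finset.card_pos.2 ⟨j, by simp⟩

lemma exists_transition_of_pairType_ne_zero {n : ℕ} {x : Fin (n + 1) → α} {u v : α}
    (h : pairType x (u, v) ≠ 0) : ∃ j : Fin n, x j.castSucc = u ∧ x j.succ = v := by
  have hc : pairCount x (u, v) ≠ 0 := fun h0 => h (by simp [pairType, h0])
  obtain ⟨j, hj⟩ := Finset.card_pos.1 (Nat.pos_of_ne_zero hc)
  simp only [Finset.mem_filter, Finset.mem_univ, true_and, Prod.mk.injEq] at hj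
  exact ⟨j, hj⟩

/-- The two marginals of an empirical distribution differ only by the end points. -/
lemma abs_marginal_sub_le {n : ℕ} (hn : 0 < n) (x : Fin (n + 1) → α) (w : α) :
    |marginal₁ (pairType x) w - marginal₂ (pairType x) w| ≤ 1 / n := by
  have hn' : (0 : ℝ) < n := by exact_mod_cast hn
  have h1 := sum_transitions_eq hn x fun u _ => if u = w then 1 else 0
  have h2 := sum_transitions_eq hn x fun _ v => if v = w then 1 else 0
  have e1 : ∑ u, ∑ v, pairType x (u, v) * (if u = w then 1 else 0) =
      marginal₁ (pairType x) w := by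
    rw [Finset.sum_eq_single w]
    · simp [marginal₁]
    · intro u _ hu
      simp [hu]
    · simp
  have e2 : ∑ u, ∑ v, pairType x (u, v) * (if v = w then 1 else 0) =
      marginal₂ (pairType x) w := by
    simp [marginal₂]
  rw [e1] at h1
  rw [e2] at h2
  -- Counting the occurrences of w at all positions, once without the last and once without the
  -- first, leaves only the end points.
  have h3 := Fin.sum_univ_castSucc fun j : Fin (n + 1) => if x j = w then (1 : ℝ) else 0
  have h4 := Fin.sum_univ_succ fun j : Fin (n + 1) => if x j = w then (1 : ℝ) else 0
  rw [h1] at h3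
  rw [h2] at h4
  rw [le_div_iff₀ hn', ← abs_of_pos hn', ← abs_mul]
  have h5 : (marginal₁ (pairType x) w - marginal₂ (pairType x) w) * n =
      (if x 0 = w then (1 : ℝ) else 0) - if x (Fin.last n) = w then (1 : ℝ) else 0 := by
    linarith
  rw [h5]
  split_ifs <;> simp

/-- The total weight of the paths of `n` steps that start at `u`. -/
def pathSum (W : α → α → ℝ) (n : ℕ) (u : α) : ℝ :=
  ∑ x : Fin n → α, ∏ j : Fin n, W ((Fin.cons u x : Fin (n + 1) → α) j.castSucc)
    ((Fin.cons u x : Fin (n + 1) → α) j.succ)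

lemma pathSum_zero (W : α → α → ℝ) (u : α) : pathSum W 0 u = 1 := by
  simp [pathSum]

lemma pathSum_succ (W : α → α → ℝ) (n : ℕ) (u : α) :
    pathSum W (n + 1) u = ∑ v, W u v * pathSum W n v := by
  rw [pathSum, ← (Fin.consEquiv fun _ : Fin (n + 1) => α).sum_comp, Fintype.sum_prod_type]
  refine Finset.sum_congr rfl fun v _ => ?_
  rw [pathSum, Finset.mul_sum]
  refine Finset.sum_congr rfl fun x _ => ?_
  rw [Fin.prod_univ_succ]
  rfl

lemma pathSum_le_one {W : α → α → ℝ} (h0 : ∀ u v, 0 ≤ W u v) (h1 : ∀ u, ∑ v, W u v ≤ 1) (n : ℕ)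
    (u : α) : pathSum W n u ≤ 1 := by
  induction n generalizing u with
  | zero => exact (pathSum_zero W u).le
  | succ n ih =>
    rw [pathSum_succ]
    refine le_trans (Finset.sum_le_sum fun v _ => ?_) (h1 u)
    exact mul_le_of_le_one_right (h0 u v) (ih v)

lemma pathSum_eq_one {W : α → α → ℝ} (h1 : ∀ u, ∑ v, W u v = 1) (n : ℕ) (u : α) :
    pathSum W n u = 1 := by
  induction n generalizing u with
  | zero => exact pathSum_zero W u
  | succ n ih =>
    rw [pathSum_succ]
    simp only [ih, mul_one, h1]

lemma sum_prod_transitions_le {W : α → α → ℝ} (h0 : ∀ u v, 0 ≤ W u v)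
    (h1 : ∀ u, ∑ v, W u v ≤ 1) (n : ℕ) :
    ∑ x : Fin (n + 1) → α, ∏ j : Fin n, W (x j.castSucc) (x j.succ) ≤ Fintype.card α := by
  rw [← (Fin.consEquiv fun _ : Fin (n + 1) => α).sum_comp, Fintype.sum_prod_type]
  calc _ ≤ ∑ _u : α, (1 : ℝ) :=
        Finset.sum_le_sum fun u _ => pathSum_le_one h0 h1 n u
    _ = _ := by simp

/-- The chain whose transition probabilities are the empirical ones of x gives its transitions
exactly this weight. Transitions that occur have positive frequency, so every logarithm is genuine.
-/
lemma rpow_neg_entropy_eq {d : ℕ} (hd : 1 < d) {n : ℕ} (hn : 0 < n) (x : Fin (n + 1) → α) :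
    (d : ℝ) ^ (-(n * pairEntropy d (pairType x))) =
      ∏ j : Fin n, condProb (pairType x) (x j.castSucc) (x j.succ) := by
  have hd' : (1 : ℝ) < d := by exact_mod_cast hd
  rw [pairEntropy_eq d (pairType_nonneg x), mul_neg, neg_neg, ← sum_transitions_eq hn x
    fun u v => Real.logb d (condProb (pairType x) u v), Real.rpow_sum_of_pos (by linarith)]
  refine Finset.prod_congr rfl fun j _ => ?_
  refine Real.rpow_logb (by linarith) hd'.ne' (div_pos (pairType_transition_pos x j) ?_)
  refine lt_of_le_of_ne (marginal₁_nonneg (pairType_nonneg x) _) fun h => ?_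
  exact (pairType_transition_pos x j).ne'
    (eq_zero_of_marginal₁_eq_zero (pairType_nonneg x) h.symm _)

/-- Bound for the number of types times the number of initial letters. -/
def typeBound (α : Type) [Fintype α] (n : ℕ) : ℝ :=
  Fintype.card α * ((n : ℝ) + 1) ^ (Fintype.card α * Fintype.card α)

lemma one_le_typeBound [Nonempty α] (n : ℕ) : 1 ≤ typeBound α n := by
  have h1 : (1 : ℝ) ≤ Fintype.card α := by exact_mod_cast Fintype.card_pos
  have h2 : (1 : ℝ) ≤ ((n : ℝ) + 1) ^ (Fintype.card α * Fintype.card α) :=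
    one_le_pow₀ (by linarith [Nat.cast_nonneg (α := ℝ) n])
  unfold typeBound
  nlinarith

/-- Within one type class the summand is the path weight of a single substochastic kernel, so the
class contributes at most one unit per initial letter. There are at most (n+1)^{|α|²} types. -/
theorem sum_rpow_neg_entropy_le {d : ℕ} (hd : 1 < d) {n : ℕ} (hn : 0 < n) :
    ∑ x : Fin (n + 1) → α, (d : ℝ) ^ (-(n * pairEntropy d (pairType x))) ≤ typeBound α n := by
  let cnt : (Fin (n + 1) → α) → α × α → Fin (n + 1) := fun x q =>
    ⟨pairCount x q, Nat.lt_succ_of_le ((Finset.card_le_univ _).trans_eq (Fintype.card_fin n))⟩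
  rw [← Finset.sum_fiberwise Finset.univ cnt]
  have hfib : ∀ c : α × α → Fin (n + 1), ∑ x with cnt x = c,
      (d : ℝ) ^ (-(n * pairEntropy d (pairType x))) ≤ Fintype.card α := by
    intro c
    let Q : α × α → ℝ := fun q => ((c q : ℕ) : ℝ) / n
    have hQ : ∀ q, 0 ≤ Q q := fun q => by positivity
    have hW0 : ∀ u v, 0 ≤ condProb Q u v := fun u v =>
      div_nonneg (hQ _) (marginal₁_nonneg hQ u)
    -- Only an inequality: a letter without outgoing transitions has a zero row, by division by
    -- zero.
    have hW1 : ∀ u, ∑ v, condProb Q u v ≤ 1 := by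
      intro u
      simp only [condProb]
      rw [← Finset.sum_div]
      exact div_self_le_one _
    calc _ = ∑ x with cnt x = c, ∏ j : Fin n, condProb Q (x j.castSucc) (x j.succ) := by
          refine Finset.sum_congr rfl fun x hx => ?_
          simp only [Finset.mem_filter, Finset.mem_univ, true_and] at hx
          have : pairType x = Q := by
            funext q
            simp only [Q, ← hx]
            rfl
          rw [rpow_neg_entropy_eq hd hn, this]
      _ ≤ ∑ x : Fin (n + 1) → α, ∏ j : Fin n, condProb Q (x j.castSucc) (x j.succ) :=
          Finset.sum_le_sum_of_subset_of_nonneg (Finset.subset_univ _)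
            fun x _ _ => Finset.prod_nonneg fun j _ => hW0 _ _
      _ ≤ _ := sum_prod_transitions_le hW0 hW1 n
  refine (Finset.sum_le_sum fun c _ => hfib c).trans ?_
  rw [Finset.sum_const, Finset.card_univ, nsmul_eq_mul, mul_comm, typeBound]
  simp

/-- Each counted sequence contributes at least d^{-nh} to the sum in `sum_rpow_neg_entropy_le`. -/
lemma card_entropy_le {d : ℕ} (hd : 1 < d) {n : ℕ} (hn : 0 < n) (h : ℝ) :
    ((Finset.univ.filter fun x : Fin (n + 1) → α => pairEntropy d (pairType x) ≤ h).card : ℝ) ≤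
      typeBound α n * (d : ℝ) ^ (n * h) := by
  have hd' : (1 : ℝ) < d := by exact_mod_cast hd
  have h1 : ((Finset.univ.filter fun x : Fin (n + 1) → α =>
      pairEntropy d (pairType x) ≤ h).card : ℝ) ≤ ∑ x : Fin (n + 1) → α,
        (d : ℝ) ^ (-(n * pairEntropy d (pairType x))) * (d : ℝ) ^ (n * h) := by
    rw [Finset.card_eq_sum_ones, Nat.cast_sum]
    refine (Finset.sum_le_sum fun x hx => ?_).trans
      (Finset.sum_le_sum_of_subset_of_nonneg (Finset.subset_univ _) fun x _ _ => by positivity)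
    simp only [Finset.mem_filter, Finset.mem_univ, true_and] at hx
    rw [← Real.rpow_add (by linarith), Nat.cast_one]
    refine Real.one_le_rpow hd'.le ?_
    have : (n : ℝ) * pairEntropy d (pairType x) ≤ n * h := by gcongr
    linarith
  refine h1.trans ?_
  rw [← Finset.sum_mul]
  gcongr
  exact sum_rpow_neg_entropy_le hd hn

end Types

/-! ### Exponential bound for the Markov law under least-entropy decoding. -/

section MarkovBound

set_option linter.unusedSectionVars false

variable {α : Type} [Fintype α] [DecidableEq α]

lemma IsProb.le_one {p : α → ℝ} (hp : IsProb p) (u : α) : p u ≤ 1 := by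
  rw [← hp.2]
  exact Finset.single_le_sum (fun v _ => hp.1 v) (Finset.mem_univ u)

lemma markovLaw_nonneg {p : α → ℝ} (hp : IsProb p) {P : α → α → ℝ} (hP : IsTransition P) {n : ℕ}
    (x : Fin (n + 1) → α) : 0 ≤ markovLaw p P x :=
  mul_nonneg (hp.1 _) (Finset.prod_nonneg fun _ _ => (hP _).1 _)

lemma sum_markovLaw {p : α → ℝ} (hp : IsProb p) {P : α → α → ℝ} (hP : IsTransition P) (n : ℕ) :
    ∑ x : Fin (n + 1) → α, markovLaw p P x = 1 := by
  rw [← (Fin.consEquiv fun _ : Fin (n + 1) => α).sum_comp, Fintype.sum_prod_type, ← hp.2]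
  refine Finset.sum_congr rfl fun u _ => ?_
  rw [← mul_one (p u), ← pathSum_eq_one (fun u => (hP u).2) n u, pathSum, Finset.mul_sum]
  rfl

lemma markovLaw_le {d : ℕ} (hd : 1 < d) {p : α → ℝ} (hp : IsProb p) {P : α → α → ℝ}
    (hP : IsTransition P) {n : ℕ} (hn : 0 < n) {x : Fin (n + 1) → α} (hx : markovLaw p P x ≠ 0) :
    pairType x ∈ feasible P ∧
      markovLaw p P x ≤ (d : ℝ) ^ (n * ∑ u, ∑ v, pairType x (u, v) * Real.logb d (P u v)) := by
  have hd' : (1 : ℝ) < d := by exact_mod_cast hd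
  have hne : ∀ j : Fin n, P (x j.castSucc) (x j.succ) ≠ 0 := fun j =>
    Finset.prod_ne_zero_iff.1 (right_ne_zero_of_mul hx) j (Finset.mem_univ j)
  refine ⟨⟨isProb_pairType hn x, fun u v huv => ?_⟩, ?_⟩
  · by_contra h
    obtain ⟨j, rfl, rfl⟩ := exists_transition_of_pairType_ne_zero h
    exact hne j huv
  · rw [← sum_transitions_eq hn x fun u v => Real.logb d (P u v),
      Real.rpow_sum_of_pos (by linarith)]
    have : ∀ j : Fin n, (d : ℝ) ^ Real.logb d (P (x j.castSucc) (x j.succ)) =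
        P (x j.castSucc) (x j.succ) := fun j =>
      Real.rpow_logb (by linarith) hd'.ne' (lt_of_le_of_ne ((hP _).1 _) (hne j).symm)
    simp only [this]
    exact mul_le_of_le_one_left (Finset.prod_nonneg fun _ _ => (hP _).1 _) (hp.le_one _)

/-- Exponential bound for the union bound of least-entropy decoding. -/
theorem markov_union_bound [Nonempty α] {d : ℕ} (hd : 1 < d) {p : α → ℝ} (hp : IsProb p)
    {P : α → α → ℝ} (hP : IsTransition P) {R E₀ : ℝ} (hE : (E₀ : EReal) < exponent d R P) :
    ∃ n₀ : ℕ, ∀ n ≥ n₀, ∀ m : ℕ, n * (1 - R) - 2 ≤ m →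
      ∑ x : Fin (n + 1) → α, markovLaw p P x * min 1 (2 * ((d : ℝ) ^ m)⁻¹ *
        (Finset.univ.filter fun x' : Fin (n + 1) → α =>
          pairEntropy d (pairType x') ≤ pairEntropy d (pairType x)).card) ≤
        2 * (d : ℝ) ^ 2 * typeBound α n ^ 2 * (d : ℝ) ^ (-(n * E₀)) := by
  have hd' : (1 : ℝ) < d := by exact_mod_cast hd
  have hd0 : (0 : ℝ) < d := by linarith
  obtain ⟨δ, hδ, hgap⟩ := exists_gap hE
  obtain ⟨n₁, hn₁⟩ := exists_nat_gt (Fintype.card α / δ)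
  refine ⟨n₁ + 1, fun n hn m hm => ?_⟩
  have hn0 : 0 < n := by omega
  have hnR : (0 : ℝ) < n := by exact_mod_cast hn0
  set K := typeBound α n with hK
  have hK1 : 1 ≤ K := one_le_typeBound n
  have hterm : ∀ x : Fin (n + 1) → α, markovLaw p P x * min 1 (2 * ((d : ℝ) ^ m)⁻¹ *
      (Finset.univ.filter fun x' : Fin (n + 1) → α =>
        pairEntropy d (pairType x') ≤ pairEntropy d (pairType x)).card) ≤
      (d : ℝ) ^ (-(n * pairEntropy d (pairType x))) *
        (2 * (d : ℝ) ^ 2 * K * (d : ℝ) ^ (-(n * E₀))) := by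
    intro x
    by_cases hx : markovLaw p P x = 0
    · rw [hx, zero_mul]
      positivity
    obtain ⟨hfeas, hle⟩ := markovLaw_le hd hp hP hn0 hx
    set H := pairEntropy d (pairType x) with hH
    set L := ∑ u, ∑ v, pairType x (u, v) * Real.logb d (P u v) with hL
    have hbal : ∑ u, |marginal₁ (pairType x) u - marginal₂ (pairType x) u| < δ := by
      refine (Finset.sum_le_sum fun u _ => abs_marginal_sub_le hn0 x u).trans_lt ?_
      rw [Finset.sum_const, Finset.card_univ, nsmul_eq_mul, mul_one_div, div_lt_comm₀ hnR hδ]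
      refine hn₁.trans_le ?_
      exact_mod_cast (by omega : n₁ ≤ n)
    have hobj := hgap _ hfeas hbal
    rw [realObjective, ← hH, ← hL] at hobj
    -- The two entries of the minimum produce the two branches of |1 - H - R|⁺; the slack of 2 in
    -- the hypothesis on m costs the factor d².
    have hmin : min 1 (2 * ((d : ℝ) ^ m)⁻¹ * (Finset.univ.filter fun x' : Fin (n + 1) → α =>
        pairEntropy d (pairType x') ≤ H).card) ≤
        2 * (d : ℝ) ^ 2 * K * (d : ℝ) ^ (-(n * max (1 - H - R) 0)) := by
      rcases le_total (1 - H - R) 0 with h0 | h0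
      · rw [max_eq_right h0, mul_zero, neg_zero, Real.rpow_zero, mul_one]
        refine (min_le_left _ _).trans ?_
        nlinarith [mul_le_mul hd'.le hd'.le zero_le_one hd0.le]
      · rw [max_eq_left h0]
        refine (min_le_right _ _).trans ?_
        have h1 := card_entropy_le (α := α) hd hn0 H
        have h2 : ((d : ℝ) ^ m)⁻¹ ≤ (d : ℝ) ^ 2 * (d : ℝ) ^ (-(n * (1 - R))) := by
          rw [← Real.rpow_natCast, ← Real.rpow_natCast, ← Real.rpow_neg hd0.le,
            ← Real.rpow_add hd0]
          refine Real.rpow_le_rpow_of_exponent_le hd'.le ?_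
          push_cast
          linarith
        calc _ ≤ 2 * ((d : ℝ) ^ 2 * (d : ℝ) ^ (-(n * (1 - R)))) * (K * (d : ℝ) ^ (n * H)) := by
              gcongr
          _ = 2 * (d : ℝ) ^ 2 * K * ((d : ℝ) ^ (-(n * (1 - R))) * (d : ℝ) ^ (n * H)) := by ring
          _ = _ := by
              rw [← Real.rpow_add hd0]
              congr 2
              ring
    -- The inequality E₀ < -H - L + |1 - H - R|⁺ trades these exponents for -nH - nE₀; keeping
    -- d^{-nH} makes the sum over x polynomial.
    calc _ ≤ (d : ℝ) ^ (n * L) * (2 * (d : ℝ) ^ 2 * K * (d : ℝ) ^ (-(n * max (1 - H - R) 0))) :=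
          mul_le_mul hle hmin (le_min zero_le_one (by positivity)) (by positivity)
      _ = 2 * (d : ℝ) ^ 2 * K * (d : ℝ) ^ (n * L + -(n * max (1 - H - R) 0)) := by
          rw [Real.rpow_add hd0]
          ring
      _ ≤ 2 * (d : ℝ) ^ 2 * K * (d : ℝ) ^ (-(n * H) + -(n * E₀)) := by
          refine mul_le_mul_of_nonneg_left
            (Real.rpow_le_rpow_of_exponent_le hd'.le ?_) (by positivity)
          nlinarith
      _ = _ := by
          rw [Real.rpow_add hd0]
          ring
  refine (Finset.sum_le_sum fun x _ => hterm x).trans ?_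
  rw [← Finset.sum_mul]
  calc _ ≤ K * (2 * (d : ℝ) ^ 2 * K * (d : ℝ) ^ (-(n * E₀))) := by
        gcongr
        exact sum_rpow_neg_entropy_le hd hn0
    _ = _ := by ring

end MarkovBound

/-! ### From finite block length to the limit inferior. -/

lemma tendsto_rate (E₀ a b : ℝ) :
    Filter.Tendsto (fun n : ℕ => (n * E₀ - (a + b * Real.log (n + 1))) / (n + 1))
      Filter.atTop (nhds E₀) := by
  have h1 : Filter.Tendsto (fun n : ℕ => Real.log ((n : ℝ) + 1) / ((n : ℝ) + 1))
      Filter.atTop (nhds 0) := by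
    have h := Real.isLittleO_log_id_atTop.tendsto_div_nhds_zero
    exact h.comp (Filter.tendsto_atTop_add_const_right _ 1 tendsto_natCast_atTop_atTop)
  have h2 : Filter.Tendsto (fun n : ℕ => 1 / ((n : ℝ) + 1)) Filter.atTop (nhds 0) :=
    tendsto_one_div_add_atTop_nhds_zero_nat
  have h3 := ((tendsto_const_nhds (x := E₀)).sub (h2.const_mul (E₀ + a))).sub (h1.const_mul b)
  simp only [mul_zero, sub_zero] at h3
  refine h3.congr fun n => ?_
  have : (n : ℝ) + 1 ≠ 0 := by positivity
  field_simp
  ring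

/-- For x ≤ 0 the right side is a negative number times ⊥, hence ⊤; only positive x needs an
argument. -/
lemma le_neg_mul_logExt {d n : ℕ} (hn : 0 < n) {x c : ℝ}
    (h : 0 < x → c ≤ -(1 / (n : ℝ)) * Real.logb d x) :
    (c : EReal) ≤ ((-(1 / (n : ℝ)) : ℝ) : EReal) * logExt d x := by
  unfold logExt
  split_ifs with hx
  · rw [EReal.coe_mul_bot_of_neg]
    · exact le_top
    · have : (0 : ℝ) < n := by exact_mod_cast hn
      exact neg_neg_of_pos (by positivity)
  · rw [← EReal.coe_mul, EReal.coe_le_coe_iff]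
    exact h (not_le.1 hx)

section Exponent

variable {d : ℕ} [Fact d.Prime] {ω : ℂ}

/-- Existence of codes of rate `R` with exponentially small infidelity. -/
theorem one_sub_optFidelity_le (hω : IsPrimitiveRoot ω d)
    {𝒜 : ∀ n : ℕ, Matrix (Idx d n) (Idx d n) ℂ →ₗ[ℂ] Matrix (Idx d n) (Idx d n) ℂ}
    (h𝒜 : ∀ n, 1 ≤ n → IsTPCP (𝒜 n))
    {p : Alphabet d → ℝ} (hp : IsProb p)
    {P : Alphabet d → Alphabet d → ℝ} (hP : IsTransition P)
    (hPA : ∀ n, IsAssociatedDistribution ω (𝒜 (n + 1)) fun x => markovLaw p P x)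
    {R : ℝ} (hR₀ : 0 ≤ R) (hR₁ : R ≤ 1) {E₀ : ℝ} (hE : (E₀ : EReal) < exponent d R P) :
    ∀ᶠ n : ℕ in Filter.atTop,
      1 - optFidelity d (n + 1) (R * (n + 1 : ℕ)) (𝒜 (n + 1)) ≤
        4 * (d : ℝ) ^ 2 * typeBound (Alphabet d) n ^ 2 * (d : ℝ) ^ (-(n * E₀)) := by
  have hd : 1 < d := (Fact.out : d.Prime).one_lt
  have hd' : (1 : ℝ) < d := by exact_mod_cast hd
  obtain ⟨n₀, hn₀⟩ := markov_union_bound hd hp hP hE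
  filter_upwards [Filter.eventually_ge_atTop n₀] with n hn
  have hTP := h𝒜 (n + 1) (by omega)
  set k := ⌈R * (n + 1 : ℕ)⌉₊ with hk
  have hkR : R * (n + 1 : ℕ) ≤ k := Nat.le_ceil _
  have hk1 : (k : ℝ) < R * (n + 1 : ℕ) + 1 := Nat.ceil_lt_add_one (by positivity)
  -- Rounding k up loses less than one, and passing from n + 1 letters to n transitions loses R ≤ 1.
  have hm : (n : ℝ) * (1 - R) - 2 ≤ (n - k : ℕ) := by
    have h1 : (n : ℝ) ≤ (n - k : ℕ) + k := by exact_mod_cast (by omega : n ≤ (n - k) + k)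
    push_cast at hk1
    linarith
  have hbound := hn₀ n hn (n - k) hm
  set r : (Fin (n + 1) → Alphabet d) → ℝ := fun x => pairEntropy d (pairType x) with hr
  -- With m = 0 every minimum in the union bound equals 1, so the claimed bound is at least 1 and no
  -- code is needed.
  rcases Nat.eq_zero_or_pos (n - k) with h0 | hpos
  · rw [h0] at hbound
    have h1 : ∀ x : Fin (n + 1) → Alphabet d, min 1 (2 * ((d : ℝ) ^ 0)⁻¹ *
        (Finset.univ.filter fun x' : Fin (n + 1) → Alphabet d => r x' ≤ r x).card) = 1 := by
      intro x
      have : 1 ≤ (Finset.univ.filter fun x' : Fin (n + 1) → Alphabet d => r x' ≤ r x).card :=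
        Finset.card_pos.2 ⟨x, by simp⟩
      have : (1 : ℝ) ≤ (Finset.univ.filter
        fun x' : Fin (n + 1) → Alphabet d => r x' ≤ r x).card := by exact_mod_cast this
      rw [min_eq_left]
      rw [pow_zero, inv_one]
      linarith
    have h2 : (1 : ℝ) ≤ 2 * (d : ℝ) ^ 2 * typeBound (Alphabet d) n ^ 2 * (d : ℝ) ^ (-(n * E₀)) := by
      refine le_trans ((sum_markovLaw hp hP n).symm.le.trans ?_) hbound
      exact (Finset.sum_congr rfl fun x _ => ((congrArg _ (h1 x)).trans (mul_one _)).symm).le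
    have := optFidelity_nonneg (k := R * (n + 1 : ℕ)) hTP
    linarith
  · obtain ⟨B, T, z, hz⟩ := exists_syndrome_decoder (m := n - k) (by omega)
      (fun x : Fin (n + 1) → Alphabet d => markovLaw p P x) (markovLaw_nonneg hp hP) r
    obtain ⟨C, ℛ, hℛ, hdim, hF⟩ := exists_weyl_code hω B T hTP (hPA n) z
    have hf : d ^ k ≤ Module.finrank ℂ C := by
      -- The factor 2 in the dimension bound is absorbed by 2 ≤ d; this is why m = n - k is used
      -- with n + 1 letters.
      have h1 : d ^ (n - k + 1) * d ^ k ≤ d ^ (n - k + 1) * Module.finrank ℂ C := by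
        rw [← pow_add, show n - k + 1 + k = n + 1 by omega]
        refine hdim.trans (Nat.mul_le_mul_right _ ?_)
        rw [pow_succ, mul_comm]
        exact Nat.mul_le_mul_left _ hd
      exact Nat.le_of_mul_le_mul_left h1 (by positivity)
    have hfpos : 0 < Module.finrank ℂ C := lt_of_lt_of_le (by positivity) hf
    have hlog : R * (n + 1 : ℕ) ≤ Real.logb d (Module.finrank ℂ C) := by
      refine hkR.trans ?_
      rw [Real.le_logb_iff_rpow_le hd' (by exact_mod_cast hfpos), Real.rpow_natCast]
      exact_mod_cast hf
    have := minFidelity_le_optFidelity hTP hℛ hfpos hlog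
    linarith [hz.trans hbound]

theorem exponent_le_liminf (hω : IsPrimitiveRoot ω d)
    {𝒜 : ∀ n : ℕ, Matrix (Idx d n) (Idx d n) ℂ →ₗ[ℂ] Matrix (Idx d n) (Idx d n) ℂ}
    (h𝒜 : ∀ n, 1 ≤ n → IsTPCP (𝒜 n))
    {p : Alphabet d → ℝ} (hp : IsProb p)
    {P : Alphabet d → Alphabet d → ℝ} (hP : IsTransition P)
    (hPA : ∀ n, IsAssociatedDistribution ω (𝒜 (n + 1)) fun x => markovLaw p P x)
    {R : ℝ} (hR₀ : 0 ≤ R) (hR₁ : R ≤ 1) :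
    exponent d R P ≤ Filter.liminf (fun n : ℕ => ((-(1 / (n : ℝ)) : ℝ) : EReal) *
        logExt d (1 - optFidelity d n (R * n) (𝒜 n))) Filter.atTop := by
  have hd : 1 < d := (Fact.out : d.Prime).one_lt
  have hd' : (1 : ℝ) < d := by exact_mod_cast hd
  refine le_of_forall_lt_imp_le_of_dense fun c hc => ?_
  -- Two numbers between c and the exponent: E₀ enters the code bound, and the gap to E₁ absorbs the
  -- polynomial factor.
  obtain ⟨E₀, hc₀, hE₀⟩ := EReal.lt_iff_exists_real_btwn.1 hc
  obtain ⟨E₁, hc₁, hE₁⟩ := EReal.lt_iff_exists_real_btwn.1 hc₀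
  have hE₁' : E₁ < E₀ := EReal.coe_lt_coe_iff.1 hE₁
  refine hc₁.le.trans (Filter.le_liminf_of_le (by isBoundedDefault) ?_)
  set q := Fintype.card (Alphabet d) with hq
  have hq0 : (0 : ℝ) < q := by exact_mod_cast Fintype.card_pos
  have hev := one_sub_optFidelity_le hω h𝒜 hp hP hPA hR₀ hR₁ hE₀
  have hrate := (tendsto_rate E₀ (Real.logb d (4 * (d : ℝ) ^ 2 * (q : ℝ) ^ 2))
    ((q * q * 2 : ℕ) / Real.log d)).eventually (lt_mem_nhds hE₁')
  have hmain : ∀ᶠ n : ℕ in Filter.atTop, (E₁ : EReal) ≤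
      ((-(1 / ((n + 1 : ℕ) : ℝ)) : ℝ) : EReal) *
        logExt d (1 - optFidelity d (n + 1) (R * (n + 1 : ℕ)) (𝒜 (n + 1))) := by
    filter_upwards [hev, hrate] with n h1 h2
    refine le_neg_mul_logExt n.succ_pos fun hx => h2.le.trans ?_
    have hn1 : (0 : ℝ) < (n : ℝ) + 1 := by positivity
    have h3 := Real.logb_le_logb_of_le hd' hx h1
    have h4 : 4 * (d : ℝ) ^ 2 * typeBound (Alphabet d) n ^ 2 =
        4 * (d : ℝ) ^ 2 * (q : ℝ) ^ 2 * ((n : ℝ) + 1) ^ (q * q * 2) := by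
      rw [typeBound, mul_pow, ← pow_mul, ← hq]
      ring
    rw [h4, Real.logb_mul (by positivity) (by positivity),
      Real.logb_mul (by positivity) (by positivity), Real.logb_rpow (by linarith) hd'.ne',
      Real.logb_pow] at h3
    rw [div_le_iff₀ hn1]
    push_cast
    have h5 : -(1 / ((n : ℝ) + 1)) *
        Real.logb d (1 - optFidelity d (n + 1) (R * ((n : ℝ) + 1)) (𝒜 (n + 1))) * ((n : ℝ) + 1) =
        -Real.logb d (1 - optFidelity d (n + 1) (R * ((n : ℝ) + 1)) (𝒜 (n + 1))) := by
      field_simp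
    rw [h5]
    push_cast at h3
    have h6 : (q : ℝ) * q * 2 / Real.log d * Real.log ((n : ℝ) + 1) =
        (q : ℝ) * q * 2 * Real.logb d ((n : ℝ) + 1) := by
      rw [Real.logb]
      ring
    rw [h6]
    linarith
  rw [← Filter.map_add_atTop_eq_nat 1, Filter.eventually_map]
  exact hmain

end Exponent

end QCode
end

theorem theorem2 (d : ℕ) [Fact d.Prime] (ω : ℂ) (hω : IsPrimitiveRoot ω d)
    (𝒜 : ∀ n : ℕ, Matrix (QCode.Idx d n) (QCode.Idx d n) ℂ →ₗ[ℂ]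
      Matrix (QCode.Idx d n) (QCode.Idx d n) ℂ)
    (h𝒜 : ∀ n, 1 ≤ n → QCode.IsTPCP (𝒜 n))
    (PA : ∀ n : ℕ, (Fin n → QCode.Alphabet d) → ℝ)
    (hPA : ∀ n, 1 ≤ n → QCode.IsAssociatedDistribution ω (𝒜 n) (PA n))
    (p : QCode.Alphabet d → ℝ) (hp : QCode.IsProb p)
    (P : QCode.Alphabet d → QCode.Alphabet d → ℝ) (hP : QCode.IsTransition P)
    (hMarkov : ∀ n : ℕ, PA (n + 1) = fun x => QCode.markovLaw p P x)
    (R : ℝ) (hR₀ : 0 ≤ R) (hR₁ : R ≤ 1) :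
    IsLeast (QCode.objectiveValues d R P) (QCode.exponent d R P) ∧
    QCode.exponent d R P ≤
      Filter.liminf (fun n : ℕ => ((-(1 / (n : ℝ)) : ℝ) : EReal) *
        QCode.logExt d (1 - QCode.optFidelity d n (R * n) (𝒜 n))) Filter.atTop := by
  refine ⟨QCode.isLeast_exponent d R P,
    QCode.exponent_le_liminf hω h𝒜 hp hP (fun n => ?_) hR₀ hR₁⟩
  rw [← hMarkov n]
  exact hPA (n + 1) (by omega)
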